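/- Let $1 \le m < s$ be integers and $k \in \{1, s-1\}$. Let $\mathcal{P}_s$ be the space of positive definite quadratic forms of determinant one on $\mathbb{R}^s$, identified with their matrices, with the distance $d(Q_1,Q_2)=\sqrt{\sum_i (\ln\lambda_i)^2}$, where $\lambda_1,\dots,\lambda_s$ are the diagonal coefficients of $Q_2$ in a $Q_1$-orthonormal basis that diagonalizes $Q_2$. Let $SL(s,\mathbb{R})$ act on the right by $Q\cdot g = g^T Q g$, put $\Gamma = SL(s,\mathbb{Z})$, and let $\mathrm{proj}:\mathcal{P}_s\to\mathcal{T}_s=\mathcal{P}_s/\Gamma$ be the projection, where $\mathcal{T}_s$ carries the quotient distance. For $1\le i\le s-1$ let $v_i=(\lambda_i,\dots,\lambda_i,-\mu_i,\dots,-\mu_i)$ with $s-i$ entries $\lambda_i=\sqrt{i/(s(s-i))}$ and $i$ entries $-\mu_i=-\sqrt{(s-i)/(si)}$, let $r_i(t)$, $t\ge 0$, be the geodesic ray of diagonal matrices with diagonal entries $e^{t (v_i)_1},\dots,e^{t (v_i)_s}$, let $\bar r_i=\mathrm{proj}\circ r_i$, and let $\bar f_i(x)=\lim_{t\to\infty}[\mathrm{dist}(x,\bar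 r_i(t))-t]$ be the Busemann function of $\bar r_i$ on $\mathcal{T}_s$. Put $\alpha_k=\langle v_k | v_m\rangle$. Two rays are asymptotic if they are at finite Hausdorff distance from each other. A geodesic ray in $\mathcal{P}_s$ has the same slope as $r_m$ if it is asymptotic to $r_m g$ for some $g\in SL(s,\mathbb{R})$. The Weyl chambers of $\mathcal{P}_s$ are the sets $W_0\cdot g$, $g\in SL(s,\mathbb{R})$, where $W_0=\{\mathrm{diag}(e^{t_1},\dots,e^{t_s}) : \sum_i t_i=0,\ t_1\ge\dots\ge t_s\}$. (i) Let $\rho$ be a geodesic ray in $\mathcal{P}_s$ of the same slope as $r_m$, and suppose that for some constant $C$ there are arbitrarily large $t$ with $-\bar f_k(\mathrm{proj}\,\rho(t))\ge\alpha_k t+C$. Then $-\bar f_k(\mathrm{proj}\,\rho(t))-\alpha_k t$ is bounded on $[0,\infty)$, and $\rho$ is asymptotic to a geodesic ray $\rho'$ that is contained in the same Weyl chamber as a lift of $\bar r_k$, that is, there are a Weyl chamber $W$ and $\gamma\in\Gamma$ such that $\rho'(t)\in W$ and $r_k(t)\gamma\in W$ for all $t\ge 0$. (ii) Hence $\alpha_k\,\mathrm{id}$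 is the maximal possible ascending function with respect to $\bar r_k$ for the slope of $r_m$: for every geodesic ray $\rho$ of the same slope as $r_m$ there is a constant $C$ with $-\bar f_k(\mathrm{proj}\,\rho(t))\le\alpha_k t+C$ for all $t\ge 0$, and there is a geodesic ray $\rho$ of the same slope as $r_m$ for which $-\bar f_k(\mathrm{proj}\,\rho(t))-\alpha_k t$ is bounded on $[0,\infty)$. -/

import Mathlib

open scoped Matrix

noncomputable section

namespace SymSpace

/-! General notions for a space `X` with a distance function `d`. A ray is a map `ℝ → X` of which
only the values at `t ≥ 0` are used. -/

/-- `r` is a geodesic ray, parametrised by arc length: an isometric embedding of `[0, ∞)`. -/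
def IsGeodesicRay {X : Type*} (d : X → X → ℝ) (r : ℝ → X) : Prop :=
  ∀ t u : ℝ, 0 ≤ t → 0 ≤ u → d (r t) (r u) = |t - u|

/-- Two rays are asymptotic if they are at finite Hausdorff distance from each other. -/
def Asymptotic {X : Type*} (d : X → X → ℝ) (r r' : ℝ → X) : Prop :=
  ∃ C : ℝ, (∀ t, 0 ≤ t → ∃ u, 0 ≤ u ∧ d (r t) (r' u) ≤ C) ∧
    (∀ u, 0 ≤ u → ∃ t, 0 ≤ t ∧ d (r t) (r' u) ≤ C)

/-- The Busemann function `x ↦ lim_{t → ∞} (d(x, r(t)) - t)` of the ray `r`. -/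
def busemann {X : Type*} (d : X → X → ℝ) (r : ℝ → X) (x : X) : ℝ :=
  Filter.limUnder Filter.atTop (fun t : ℝ => d x (r t) - t)

/-! The symmetric space. -/

/-- Positive definite quadratic forms of determinant one on `ℝ^s`, given by their matrices. -/
def P (s : ℕ) : Type := {M : Matrix (Fin s) (Fin s) ℝ // M.PosDef ∧ M.det = 1}

/-- The distance `√(∑ (ln λ_i)²)`, where `λ_1, …, λ_s` are the diagonal coefficients of `Q₂` in a
basis that is orthonormal for `Q₁` and orthogonal for `Q₂`. If `B` is the matrix of such a basis,
`Bᵀ Q₁ B = 1` and `Bᵀ Q₂ B = diag(λ)`, then `Q₁⁻¹ Q₂ = B diag(λ) B⁻¹`, so the `λ_i` are the roots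
of the characteristic polynomial of `Q₁⁻¹ Q₂`, with multiplicity. -/
def distP {s : ℕ} (Q₁ Q₂ : P s) : ℝ :=
  Real.sqrt (((Q₁.1⁻¹ * Q₂.1).charpoly.roots.map (fun x => Real.log x ^ 2)).sum)

/-- The right action `(Q, g) ↦ Q ∘ g` of `SL(s, ℝ)`, in matrices `(M, g) ↦ gᵀ M g`. -/
def act {s : ℕ} (Q : P s) (g : Matrix.SpecialLinearGroup (Fin s) ℝ) : P s :=
  ⟨g.1ᵀ * Q.1 * g.1, by
    have hu : IsUnit g.1 := (Matrix.isUnit_iff_isUnit_det _).2 (by simp [g.2])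
    have h := (Matrix.IsUnit.posDef_star_left_conjugate_iff (x := Q.1) hu).2 Q.2.1
    simpa [Matrix.star_eq_conjTranspose, Matrix.conjTranspose_eq_transpose_of_trivial] using h,
    by simp [Matrix.det_mul, Matrix.det_transpose, g.2, Q.2.2]⟩

/-- The inclusion of `SL(s, ℤ)` into `SL(s, ℝ)`. -/
def toReal {s : ℕ} (B : Matrix.SpecialLinearGroup (Fin s) ℤ) :
    Matrix.SpecialLinearGroup (Fin s) ℝ :=
  Matrix.SpecialLinearGroup.map (Int.castRingHom ℝ) B

theorem act_one {s : ℕ} (Q : P s) : act Q 1 = Q := by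
  apply Subtype.ext
  simp [act]

theorem act_mul {s : ℕ} (Q : P s) (g h : Matrix.SpecialLinearGroup (Fin s) ℝ) :
    act Q (g * h) = act (act Q g) h := by
  apply Subtype.ext
  simp [act, Matrix.transpose_mul, Matrix.mul_assoc]

/-! The locally symmetric space. -/

/-- `Q₁ ≃ Q₂` if `Q₁ = Q₂ ∘ B` for some `B ∈ SL(s, ℤ)`. -/
def latticeSetoid (s : ℕ) : Setoid (P s) where
  r Q₁ Q₂ := ∃ B : Matrix.SpecialLinearGroup (Fin s) ℤ, Q₁ = act Q₂ (toReal B)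
  iseqv :=
    { refl := fun Q => ⟨1, by simp [toReal, act_one]⟩
      symm := by
        rintro Q₁ Q₂ ⟨B, rfl⟩
        exact ⟨B⁻¹, by rw [← act_mul]; simp [toReal, act_one]⟩
      trans := by
        rintro Q₁ Q₂ Q₃ ⟨B, rfl⟩ ⟨B', rfl⟩
        exact ⟨B' * B, by rw [← act_mul]; simp [toReal]⟩ }

/-- The locally symmetric space `P_s / SL(s, ℤ)`. -/
def T (s : ℕ) : Type := Quotient (latticeSetoid s)

/-- The projection of `P_s` onto `P_s / SL(s, ℤ)`. -/
def proj {s : ℕ} (Q : P s) : T s := Quotient.mk (latticeSetoid s) Q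

/-- The quotient distance: the infimum of the distances between representatives. -/
def distT {s : ℕ} (x y : T s) : ℝ :=
  sInf {a : ℝ | ∃ Q₁ Q₂ : P s, proj Q₁ = x ∧ proj Q₂ = y ∧ a = distP Q₁ Q₂}

/-! The singular rays, the slope and the Weyl chambers. -/

/-- `λ_i = √(i / (s (s - i)))`. -/
def lam (s i : ℕ) : ℝ := Real.sqrt ((i : ℝ) / ((s : ℝ) * ((s : ℝ) - (i : ℝ))))

/-- `μ_i = √((s - i) / (s i))`. -/
def mu (s i : ℕ) : ℝ := Real.sqrt (((s : ℝ) - (i : ℝ)) / ((s : ℝ) * (i : ℝ)))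

/-- The unit vector `v_i = (λ_i, …, λ_i, -μ_i, …, -μ_i)`, with `s - i` entries `λ_i` followed by
`i` entries `-μ_i`, for `1 ≤ i ≤ s - 1`. -/
def vec (s i : ℕ) : Fin s → ℝ := fun j => if (j : ℕ) < s - i then lam s i else -mu s i

theorem sum_vec (s i : ℕ) : ∑ j, vec s i j = 0 := by
  have h : ∑ j, vec s i j = ((s - i : ℕ) : ℝ) * lam s i - ((min s i : ℕ) : ℝ) * mu s i := by
    have h2 : ∀ j : Fin s, vec s i j = (fun n : ℕ => if n < s - i then lam s i else -mu s i) j :=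
      fun j => rfl
    rw [Finset.sum_congr rfl (fun j _ => h2 j), Fin.sum_univ_eq_sum_range
      (fun n : ℕ => if n < s - i then lam s i else -mu s i) s, Finset.sum_ite]
    have e1 : (Finset.range s).filter (fun n => n < s - i) = Finset.range (s - i) := by
      ext n; simp; omega
    have e2 : (Finset.range s).filter (fun n => ¬ n < s - i) = Finset.Ico (s - i) s := by
      ext n; simp; omega
    have e3 : s - (s - i) = min s i := by omega
    rw [e1, e2]
    simp [e3]
    ring
  rw [h]
  rcases Nat.eq_zero_or_pos i with rfl | hi
  · simp [lam]
  rcases le_or_gt s i with hs | hs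
  · have : ((s : ℝ) - (i : ℝ)) / ((s : ℝ) * (i : ℝ)) ≤ 0 := by
      apply div_nonpos_of_nonpos_of_nonneg
      · have : (s : ℝ) ≤ i := by exact_mod_cast hs
        linarith
      · positivity
    simp [mu, Nat.sub_eq_zero_of_le hs, Real.sqrt_eq_zero_of_nonpos this]
  · have hi' : (0 : ℝ) < i := by exact_mod_cast hi
    have hd : (0 : ℝ) < (s : ℝ) - i := by
      have : (i : ℝ) < s := by exact_mod_cast hs
      linarith
    have hs' : (0 : ℝ) < s := by linarith
    rw [min_eq_right hs.le, Nat.cast_sub hs.le, sub_eq_zero]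
    rw [lam, mu, ← Real.sqrt_sq hd.le, ← Real.sqrt_mul (by positivity),
      Real.sqrt_sq hd.le]
    conv_rhs => rw [← Real.sqrt_sq hi'.le, ← Real.sqrt_mul (by positivity), Real.sqrt_sq hi'.le]
    congr 1
    field_simp

/-- The quadratic form `diag(e^{t_1}, …, e^{t_s})`, for `t_1 + ⋯ + t_s = 0`. -/
def diagForm {s : ℕ} (t : Fin s → ℝ) (ht : ∑ j, t j = 0) : P s :=
  ⟨Matrix.diagonal (fun j => Real.exp (t j)),
    Matrix.PosDef.diagonal (fun j => Real.exp_pos (t j)),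
    by rw [Matrix.det_diagonal, ← Real.exp_sum, ht, Real.exp_zero]⟩

/-- The ray `r_i(t) = diag(e^{λ_i t}, …, e^{λ_i t}, e^{-μ_i t}, …, e^{-μ_i t})`, `1 ≤ i ≤ s - 1`. -/
def ray (s i : ℕ) (t : ℝ) : P s :=
  diagForm (fun j => vec s i j * t) (by rw [← Finset.sum_mul, sum_vec, zero_mul])

/-- The points at infinity of `ρ` and `σ` lie in the same `SL(s, ℝ)`-orbit, that is, `ρ` and `σ`
have the same slope. -/
def SameSlope {s : ℕ} (ρ σ : ℝ → P s) : Prop :=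
  ∃ g : Matrix.SpecialLinearGroup (Fin s) ℝ, Asymptotic distP ρ (fun t => act (σ t) g)

/-- The standard (closed) Weyl chamber `{diag(e^{t_1}, …, e^{t_s}) ; ∑ t_i = 0, t_1 ≥ ⋯ ≥ t_s}`. -/
def standardChamber (s : ℕ) : Set (P s) :=
  {Q | ∃ (t : Fin s → ℝ) (ht : ∑ j, t j = 0), Antitone t ∧ Q = diagForm t ht}

/-- The Weyl chambers of `P_s` are the translates of the standard one under `SL(s, ℝ)`. -/
def IsWeylChamber {s : ℕ} (W : Set (P s)) : Prop :=
  ∃ g : Matrix.SpecialLinearGroup (Fin s) ℝ, W = (fun Q => act Q g) '' standardChamber s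

/-- The Busemann function on `P_s / SL(s, ℤ)` of the projection of the ray `r_k`. -/
def fbar (s k : ℕ) : T s → ℝ := busemann distT (fun t => proj (ray s k t))

/-- `α_k = ⟨v_k | v_m⟩`. -/
def alpha (s m k : ℕ) : ℝ := vec s k ⬝ᵥ vec s m

end SymSpace

end

open SymSpace

open scoped Matrix

noncomputable section

namespace SymSpace

open Matrix Filter Topology

/-! On the quotient, the Busemann function of `r_1` measures short lattice vectors: `fbar s 1 (proj
Q)` is `μ_1⁻¹ log min Q(γ e)`, where `e` is the last basis vector and `γ` runs over `SL(s, ℤ)`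
(`fbar_one_eq`). The distance to `r_1(t)` is bounded below by a sharp estimate of relative
eigenvalues (`le_distP_ray_one`) and above by a trace estimate (`distP_ray_one_sq_le`).

Along a translate `r_m g`, the value of the form at a vector is a sum of terms growing like `e^{λ_m
t}` and terms decaying like `e^{-μ_m t}`. The minimum therefore decays no faster than `e^{-μ_m t}`,
which means an ascent of speed at most `μ_m / μ_1 = α_1` (`neg_fbar_one_ray_le`). If this speed is
reached at arbitrarily large times, the lattice vectors responsible have bounded value at time 0, so
they are finite in number and one of them, `v = γ e`, serves at arbitrarily large times. Then `g v`
has no component in the growing directions (`exists_orbit_mem_of_frequently`), so speed `α_1` is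
kept at all times (`le_neg_fbar_one_ray`).

For the chamber, orthonormalization along a flag factors `g γ = p q` with `p` in the parabolic
subgroup of `r_m` and `q` a rotation preserving the line of `e` (`exists_rotation`). Then `r_m g` is
asymptotic to `r_m q γ⁻¹`, and `q` fixes `r_1` pointwise, so `r_m q γ⁻¹` and `r_1 γ⁻¹` both lie in
`W_0 q γ⁻¹` (`exists_chamber`).

Every ray of the slope of `r_m` stays at bounded distance from some `r_m g`, and `fbar` is
1-Lipschitz, so the conclusions pass to all such rays. The case `k = s - 1` follows from the
polarity `Q ↦ J Q⁻¹ J`, which exchanges `r_i` and `r_{s-i}` (`MaximalAscent.dual`). -/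

/-- The value of a quadratic form at a vector. -/
def qf {s : ℕ} (Q : P s) (v : Fin s → ℝ) : ℝ := v ⬝ᵥ Q.1 *ᵥ v

theorem qf_act {s : ℕ} (Q : P s) (g : Matrix.SpecialLinearGroup (Fin s) ℝ) (v : Fin s → ℝ) :
    qf (act Q g) v = qf Q (g.1 *ᵥ v) := by
  have h (M : Matrix (Fin s) (Fin s) ℝ) :
      v ⬝ᵥ (g.1ᵀ * M * g.1) *ᵥ v = (g.1 *ᵥ v) ⬝ᵥ M *ᵥ (g.1 *ᵥ v) := by
    rw [← Matrix.mulVec_mulVec, ← Matrix.mulVec_mulVec, Matrix.dotProduct_mulVec,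
      Matrix.vecMul_transpose]
  exact h Q.1

theorem qf_diagForm {s : ℕ} (t : Fin s → ℝ) (ht : ∑ j, t j = 0) (v : Fin s → ℝ) :
    qf (diagForm t ht) v = ∑ j, Real.exp (t j) * v j ^ 2 := by
  simp only [qf, diagForm, dotProduct, Matrix.mulVec_diagonal]
  exact Finset.sum_congr rfl fun j _ => by ring

theorem qf_pos {s : ℕ} (Q : P s) {v : Fin s → ℝ} (hv : v ≠ 0) : 0 < qf Q v := by
  simpa [qf] using Q.2.1.dotProduct_mulVec_pos hv

theorem qf_nonneg {s : ℕ} (Q : P s) (v : Fin s → ℝ) : 0 ≤ qf Q v := by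
  simpa [qf] using Q.2.1.posSemidef.dotProduct_mulVec_nonneg v

theorem dotProduct_gram_diagonal {s : ℕ} (g : Matrix (Fin s) (Fin s) ℝ) (d v : Fin s → ℝ) :
    v ⬝ᵥ (gᵀ * diagonal d * g) *ᵥ v = ∑ i, d i * (g *ᵥ v) i ^ 2 := by
  rw [← Matrix.mulVec_mulVec, ← Matrix.mulVec_mulVec, Matrix.dotProduct_mulVec,
    Matrix.vecMul_transpose]
  simp only [dotProduct, Matrix.mulVec_diagonal]
  exact Finset.sum_congr rfl fun j _ => by ring

/-! ### Simultaneous diagonalization and the distance formula. -/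

/-- A real positive definite matrix is orthogonally diagonalizable. -/
theorem exists_orthogonal_diagonal {s : ℕ} {M : Matrix (Fin s) (Fin s) ℝ} (hM : M.PosDef) :
    ∃ (U : Matrix (Fin s) (Fin s) ℝ) (d : Fin s → ℝ), Uᵀ * U = 1 ∧ (∀ i, 0 < d i) ∧
      M = Uᵀ * diagonal d * U := by
  refine ⟨(hM.1.eigenvectorUnitary : Matrix (Fin s) (Fin s) ℝ)ᵀ, hM.1.eigenvalues, ?_,
    hM.eigenvalues_pos, ?_⟩
  · have := Unitary.coe_mul_star_self hM.1.eigenvectorUnitary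
    simpa [Matrix.star_eq_conjTranspose, conjTranspose_eq_transpose_of_trivial] using this
  · have := hM.1.spectral_theorem
    rw [Unitary.conjStarAlgAut_apply] at this
    simpa [Matrix.star_eq_conjTranspose, conjTranspose_eq_transpose_of_trivial] using this

/-- Simultaneous diagonalization of two positive definite forms, with ordered coefficients. -/
theorem exists_simultaneous_diagonal {s : ℕ} (Q R : P s) :
    ∃ (g : Matrix (Fin s) (Fin s) ℝ) (x : Fin s → ℝ), Antitone x ∧ IsUnit g.det ∧
      Q.1 = gᵀ * g ∧ R.1 = gᵀ * diagonal (fun i => Real.exp (x i)) * g := by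
  obtain ⟨U, d, hU, hd, hQ⟩ := exists_orthogonal_diagonal Q.2.1
  set B := diagonal (fun i => Real.sqrt (d i)) * U with hB
  have hBQ : Q.1 = Bᵀ * B := by
    have : diagonal (fun i => Real.sqrt (d i)) * diagonal (fun i => Real.sqrt (d i))
        = diagonal d := by
      rw [diagonal_mul_diagonal]
      congr 1; ext i; exact Real.mul_self_sqrt (hd i).le
    rw [hQ, hB, transpose_mul, diagonal_transpose, ← this]
    simp only [Matrix.mul_assoc]
  have hBu : IsUnit B.det := by
    have := Q.2.2
    rw [hBQ, det_mul, det_transpose] at this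
    exact IsUnit.of_mul_eq_one _ this
  have hBi : IsUnit B⁻¹ := by
    rw [Matrix.isUnit_iff_isUnit_det]; exact Matrix.isUnit_nonsing_inv_det _ hBu
  have hH : (B⁻¹ᵀ * R.1 * B⁻¹).PosDef := by
    have h := (Matrix.IsUnit.posDef_star_left_conjugate_iff (x := R.1) hBi).2 R.2.1
    simpa [Matrix.star_eq_conjTranspose, conjTranspose_eq_transpose_of_trivial] using h
  obtain ⟨V, e, hV, he, hR⟩ := exists_orthogonal_diagonal hH
  have hR' : R.1 = (V * B)ᵀ * diagonal e * (V * B) := by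
    have h1 : Bᵀ * (B⁻¹ᵀ * R.1 * B⁻¹) * B = R.1 := by
      have e1 : Bᵀ * B⁻¹ᵀ = 1 := by
        rw [← transpose_mul, Matrix.nonsing_inv_mul _ hBu, transpose_one]
      have e2 : B⁻¹ * B = 1 := Matrix.nonsing_inv_mul _ hBu
      calc _ = (Bᵀ * B⁻¹ᵀ) * R.1 * (B⁻¹ * B) := by simp only [Matrix.mul_assoc]
        _ = _ := by rw [e1, e2]; simp
    rw [← h1, hR, transpose_mul V B]
    simp only [Matrix.mul_assoc]
  have hQ' : Q.1 = (V * B)ᵀ * (V * B) := by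
    rw [transpose_mul, Matrix.mul_assoc, ← Matrix.mul_assoc Vᵀ, hV, Matrix.one_mul, hBQ]
  -- Sorting the negated logarithms in increasing order puts the coefficients in decreasing order.
  set σ := Tuple.sort (fun i => - Real.log (e i)) with hσ
  have hmono := Tuple.monotone_sort (fun i => - Real.log (e i))
  have hVu : IsUnit V.det := by
    have := congrArg Matrix.det hV
    rw [det_mul, det_one] at this
    exact IsUnit.of_mul_eq_one_right _ this
  refine ⟨(V * B).submatrix σ id, fun i => Real.log (e (σ i)), ?_, ?_, ?_, ?_⟩
  · intro i j hij
    have := hmono hij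
    simp only [Function.comp] at this
    exact neg_le_neg_iff.1 this
  · rw [det_permute, det_mul]
    exact ((Units.isUnit _).map (Int.castRingHom ℝ)).mul (hVu.mul hBu)
  · rw [transpose_submatrix, submatrix_mul_equiv, ← hQ', submatrix_id_id]
  · have h3 : diagonal (fun i => Real.exp (Real.log (e (σ i)))) = (diagonal e).submatrix σ σ := by
      rw [submatrix_diagonal_equiv]
      congr 1; ext i; exact Real.exp_log (he _)
    rw [h3, transpose_submatrix, submatrix_mul_equiv, submatrix_mul_equiv, ← hR', submatrix_id_id]

theorem inv_mul_gram {s : ℕ} {g : Matrix (Fin s) (Fin s) ℝ} (hg : IsUnit g.det)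
    (D : Matrix (Fin s) (Fin s) ℝ) : (gᵀ * g)⁻¹ * (gᵀ * D * g) = g⁻¹ * D * g := by
  have h : gᵀ⁻¹ * gᵀ = 1 := Matrix.nonsing_inv_mul _ (by rwa [det_transpose])
  rw [Matrix.mul_inv_rev]
  calc _ = g⁻¹ * (gᵀ⁻¹ * gᵀ) * D * g := by simp only [Matrix.mul_assoc]
    _ = _ := by rw [h]; simp

theorem charpoly_conj {s : ℕ} {g : Matrix (Fin s) (Fin s) ℝ} (hg : IsUnit g.det)
    (D : Matrix (Fin s) (Fin s) ℝ) : (g⁻¹ * D * g).charpoly = D.charpoly := by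
  rw [Matrix.charpoly_mul_comm, ← Matrix.mul_assoc, Matrix.mul_nonsing_inv _ hg, Matrix.one_mul]

/-- `Q⁻¹ R` is conjugate to the diagonal matrix by `g`, so the roots of its characteristic
polynomial are the `e^{x i}`. -/
theorem distP_eq_of_gram {s : ℕ} {Q R : P s} {g : Matrix (Fin s) (Fin s) ℝ} {x : Fin s → ℝ}
    (hg : IsUnit g.det) (hQ : Q.1 = gᵀ * g)
    (hR : R.1 = gᵀ * diagonal (fun i => Real.exp (x i)) * g) :
    distP Q R = Real.sqrt (∑ i, x i ^ 2) := by
  rw [distP, hQ, hR, inv_mul_gram hg, charpoly_conj hg, charpoly_diagonal,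
    Polynomial.roots_prod _ _ (Finset.prod_ne_zero_iff.2 fun i _ => Polynomial.X_sub_C_ne_zero _)]
  simp only [Polynomial.roots_X_sub_C, Multiset.bind_singleton, Multiset.map_map]
  simp [Finset.sum]

theorem sum_eq_zero_of_gram {s : ℕ} {Q R : P s} {g : Matrix (Fin s) (Fin s) ℝ} {x : Fin s → ℝ}
    (hQ : Q.1 = gᵀ * g) (hR : R.1 = gᵀ * diagonal (fun i => Real.exp (x i)) * g) :
    ∑ i, x i = 0 := by
  have h1 := Q.2.2
  have h2 := R.2.2
  rw [hQ, det_mul, det_transpose] at h1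
  rw [hR, det_mul, det_mul, det_transpose, det_diagonal, ← Real.exp_sum, mul_right_comm, h1,
    one_mul] at h2
  exact (Real.exp_eq_one_iff _).1 h2

theorem trace_eq_of_gram {s : ℕ} {Q R : P s} {g : Matrix (Fin s) (Fin s) ℝ} {x : Fin s → ℝ}
    (hg : IsUnit g.det) (hQ : Q.1 = gᵀ * g)
    (hR : R.1 = gᵀ * diagonal (fun i => Real.exp (x i)) * g) :
    (Q.1⁻¹ * R.1).trace = ∑ i, Real.exp (x i) := by
  rw [hQ, hR, inv_mul_gram hg, trace_mul_comm, ← Matrix.mul_assoc, Matrix.mul_nonsing_inv _ hg,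
    Matrix.one_mul, trace_diagonal]

theorem qf_left_of_gram {s : ℕ} {Q : P s} {g : Matrix (Fin s) (Fin s) ℝ}
    (hQ : Q.1 = gᵀ * g) (v : Fin s → ℝ) : qf Q v = ∑ i, (g *ᵥ v) i ^ 2 := by
  have := dotProduct_gram_diagonal g 1 v
  simpa [qf, hQ] using this

theorem qf_right_of_gram {s : ℕ} {R : P s} {g : Matrix (Fin s) (Fin s) ℝ} {x : Fin s → ℝ}
    (hR : R.1 = gᵀ * diagonal (fun i => Real.exp (x i)) * g) (v : Fin s → ℝ) :
    qf R v = ∑ i, Real.exp (x i) * (g *ᵥ v) i ^ 2 := by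
  rw [qf, hR, dotProduct_gram_diagonal]

theorem distP_nonneg {s : ℕ} (Q R : P s) : 0 ≤ distP Q R := Real.sqrt_nonneg _

theorem distP_comm {s : ℕ} (Q R : P s) : distP Q R = distP R Q := by
  obtain ⟨g, x, -, hg, hQ, hR⟩ := exists_simultaneous_diagonal Q R
  rw [distP_eq_of_gram hg hQ hR]
  -- Rescaling the common basis makes `R` the unit form; the relative exponents become `-x`.
  set h := diagonal (fun i => Real.exp (x i / 2)) * g with hh
  have hR' : R.1 = hᵀ * h := by
    have : diagonal (fun i => Real.exp (x i / 2)) * diagonal (fun i => Real.exp (x i / 2))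
        = diagonal (fun i => Real.exp (x i)) := by
      rw [diagonal_mul_diagonal]
      congr 1; ext i; rw [← Real.exp_add]; ring_nf
    rw [hR, hh, transpose_mul, diagonal_transpose, ← this]
    simp only [Matrix.mul_assoc]
  have hQ' : Q.1 = hᵀ * diagonal (fun i => Real.exp (- x i)) * h := by
    have : diagonal (fun i => Real.exp (x i / 2)) * diagonal (fun i => Real.exp (- x i)) *
        diagonal (fun i => Real.exp (x i / 2)) = 1 := by
      rw [diagonal_mul_diagonal, diagonal_mul_diagonal, ← diagonal_one]
      congr 1; ext i; rw [← Real.exp_add, ← Real.exp_add, ← Real.exp_zero]; ring_nf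
    rw [hQ, hh, transpose_mul, diagonal_transpose]
    calc _ = gᵀ * (1 * g) := by simp
      _ = _ := by rw [← this]; simp only [Matrix.mul_assoc]
  have hu : IsUnit h.det := by
    have := R.2.2
    rw [hR', det_mul, det_transpose] at this
    exact IsUnit.of_mul_eq_one _ this
  rw [distP_eq_of_gram hu hR' hQ']
  simp

theorem distP_act {s : ℕ} (Q R : P s) (g : Matrix.SpecialLinearGroup (Fin s) ℝ) :
    distP (act Q g) (act R g) = distP Q R := by
  obtain ⟨h, x, -, hh, hQ, hR⟩ := exists_simultaneous_diagonal Q R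
  rw [distP_eq_of_gram hh hQ hR, distP_eq_of_gram (g := h * g.1) (x := x)]
  · rw [det_mul, g.2, mul_one]; exact hh
  · simp only [act, hQ, transpose_mul, Matrix.mul_assoc]
  · simp only [act, hR, transpose_mul, Matrix.mul_assoc]

/-! ### Distance against domination of quadratic forms. -/

theorem abs_le_sqrt_sum_sq {s : ℕ} (x : Fin s → ℝ) (i : Fin s) :
    |x i| ≤ Real.sqrt (∑ j, x j ^ 2) := by
  rw [← Real.sqrt_sq_eq_abs]
  exact Real.sqrt_le_sqrt
    (Finset.single_le_sum (f := fun j => x j ^ 2) (fun j _ => sq_nonneg _) (Finset.mem_univ i))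

theorem sqrt_sum_sq_le {s : ℕ} {x : Fin s → ℝ} {C : ℝ} (h : ∀ i, |x i| ≤ C) (hC : 0 ≤ C) :
    Real.sqrt (∑ j, x j ^ 2) ≤ Real.sqrt s * C := by
  have : ∑ j, x j ^ 2 ≤ s * C ^ 2 := by
    refine (Finset.sum_le_sum fun j _ => sq_le_sq' (neg_le_of_abs_le (h j))
      (le_of_abs_le (h j))).trans ?_
    simp
  calc _ ≤ Real.sqrt (s * C ^ 2) := Real.sqrt_le_sqrt this
    _ = _ := by rw [Real.sqrt_mul (by positivity), Real.sqrt_sq hC]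

/-- A coordinate of a vector of sum zero is at most `√((s - 1) / s)` times the norm. -/
theorem le_mu_mul_sqrt_sum_sq {s : ℕ} {x : Fin s → ℝ} (hx : ∑ j, x j = 0) (i : Fin s) :
    x i ≤ mu s 1 * Real.sqrt (∑ j, x j ^ 2) := by
  have hs : (1 : ℝ) ≤ s := by exact_mod_cast i.pos
  have h1 : x i + ∑ j ∈ Finset.univ.erase i, x j = 0 := by
    rw [Finset.add_sum_erase _ _ (Finset.mem_univ i), hx]
  have h2 := Finset.add_sum_erase Finset.univ (fun j => x j ^ 2) (Finset.mem_univ i)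
  -- Cauchy–Schwarz on the other `s - 1` coordinates, whose sum is `-x i`.
  have h3 : (∑ j ∈ Finset.univ.erase i, x j) ^ 2
      ≤ ((s : ℝ) - 1) * ∑ j ∈ Finset.univ.erase i, x j ^ 2 := by
    refine sq_sum_le_card_mul_sum_sq.trans_eq ?_
    rw [Finset.card_erase_of_mem (Finset.mem_univ i), Finset.card_univ, Fintype.card_fin,
      Nat.cast_sub i.pos, Nat.cast_one]
  have h4 : (∑ j ∈ Finset.univ.erase i, x j) ^ 2 = x i ^ 2 := by
    rw [eq_neg_of_add_eq_zero_right h1, neg_sq]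
  have h5 : x i ^ 2 ≤ ((s : ℝ) - 1) / (s * (1 : ℕ)) * ∑ j, x j ^ 2 := by
    rw [Nat.cast_one, mul_one, div_mul_eq_mul_div, le_div_iff₀ (by linarith)]
    rw [h4] at h3
    rw [← h2]
    linarith
  rw [mu, Nat.cast_one, ← Real.sqrt_mul (by rw [mul_one]; exact div_nonneg (by linarith) (by linarith))]
  exact Real.le_sqrt_of_sq_le (by simpa using h5)

theorem qf_le_of_gram {s : ℕ} {Q R : P s} {g : Matrix (Fin s) (Fin s) ℝ} {x : Fin s → ℝ}
    (hQ : Q.1 = gᵀ * g) (hR : R.1 = gᵀ * diagonal (fun i => Real.exp (x i)) * g) {C : ℝ}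
    (hx : ∀ i, x i ≤ C) (v : Fin s → ℝ) : qf R v ≤ Real.exp C * qf Q v := by
  rw [qf_left_of_gram hQ, qf_right_of_gram hR, Finset.mul_sum]
  exact Finset.sum_le_sum fun i _ =>
    mul_le_mul_of_nonneg_right (Real.exp_le_exp.2 (hx i)) (sq_nonneg _)

/-- Relative exponents have sum zero because both determinants are one. This improves the constant 1
of `qf_le_exp` to `mu s 1`, which makes the lower bound for the Busemann function exact and `fbar`
1-Lipschitz. -/
theorem qf_le_exp_mu {s : ℕ} (Q R : P s) (v : Fin s → ℝ) :
    qf R v ≤ Real.exp (mu s 1 * distP Q R) * qf Q v := by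
  obtain ⟨g, x, -, hg, hQ, hR⟩ := exists_simultaneous_diagonal Q R
  rw [distP_eq_of_gram hg hQ hR]
  exact qf_le_of_gram hQ hR (le_mu_mul_sqrt_sum_sq (sum_eq_zero_of_gram hQ hR)) v

theorem qf_le_exp {s : ℕ} (Q R : P s) (v : Fin s → ℝ) :
    qf R v ≤ Real.exp (distP Q R) * qf Q v := by
  obtain ⟨g, x, -, hg, hQ, hR⟩ := exists_simultaneous_diagonal Q R
  rw [distP_eq_of_gram hg hQ hR]
  exact qf_le_of_gram hQ hR (fun i => (le_abs_self _).trans (abs_le_sqrt_sum_sq x i)) v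

/-- These are `s - 1` linear conditions on `s` unknowns. Such a `v` is the test vector for the
min-max comparison of eigenvalues. -/
theorem exists_ne_zero_of_lt {s : ℕ} (g h : Matrix (Fin s) (Fin s) ℝ) (i : Fin s) :
    ∃ v : Fin s → ℝ, v ≠ 0 ∧ (∀ j, j < i → (g *ᵥ v) j = 0) ∧ ∀ j, i < j → (h *ᵥ v) j = 0 := by
  let f : (Fin s → ℝ) →ₗ[ℝ] ({j : Fin s // j ≠ i} → ℝ) :=
    LinearMap.pi fun j => if (j : Fin s) < i then (LinearMap.proj (j : Fin s)) ∘ₗ g.mulVecLin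
      else (LinearMap.proj (j : Fin s)) ∘ₗ h.mulVecLin
  have hf : LinearMap.ker f ≠ ⊥ := by
    apply LinearMap.ker_ne_bot_of_finrank_lt
    have := i.pos
    simp
    omega
  obtain ⟨v, hv, hv0⟩ := (Submodule.ne_bot_iff _).1 hf
  have hj (j : Fin s) (hji : j ≠ i) := congrFun (LinearMap.mem_ker.1 hv) ⟨j, hji⟩
  refine ⟨v, hv0, fun j hlt => ?_, fun j hlt => ?_⟩
  · simpa [f, hlt] using hj j hlt.ne
  · simpa [f, hlt.not_gt] using hj j hlt.ne'

/-- Monotonicity of the ordered relative eigenvalues, in the manner of Courant and Fischer. -/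
theorem le_add_of_qf_le {s : ℕ} {Q Q' R : P s} {g g' : Matrix (Fin s) (Fin s) ℝ}
    {x x' : Fin s → ℝ} (hx : Antitone x) (hx' : Antitone x')
    (hQ : Q.1 = gᵀ * g) (hR : R.1 = gᵀ * diagonal (fun i => Real.exp (x i)) * g)
    (hQ' : Q'.1 = g'ᵀ * g') (hR' : R.1 = g'ᵀ * diagonal (fun i => Real.exp (x' i)) * g')
    {C : ℝ} (h : ∀ v, qf Q v ≤ Real.exp C * qf Q' v) (i : Fin s) : x' i ≤ x i + C := by
  -- On `v` only the exponents of index at least `i` in `x`, and at most `i` in `x'`, are felt, so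
  -- `R ≤ e^{x i} Q` and `R ≥ e^{x' i} Q'` there.
  obtain ⟨v, hv0, hv, hv'⟩ := exists_ne_zero_of_lt g g' i
  have h1 : qf R v ≤ Real.exp (x i) * qf Q v := by
    rw [qf_left_of_gram hQ, qf_right_of_gram hR, Finset.mul_sum]
    refine Finset.sum_le_sum fun j _ => ?_
    rcases lt_or_ge j i with hj | hj
    · simp [hv j hj]
    · exact mul_le_mul_of_nonneg_right (Real.exp_le_exp.2 (hx hj)) (sq_nonneg _)
  have h2 : Real.exp (x' i) * qf Q' v ≤ qf R v := by
    rw [qf_left_of_gram hQ', qf_right_of_gram hR', Finset.mul_sum]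
    refine Finset.sum_le_sum fun j _ => ?_
    rcases lt_or_ge i j with hj | hj
    · simp [hv' j hj]
    · exact mul_le_mul_of_nonneg_right (Real.exp_le_exp.2 (hx' hj)) (sq_nonneg _)
  have h3 : Real.exp (x' i) * qf Q' v ≤ Real.exp (x i + C) * qf Q' v := by
    rw [Real.exp_add, mul_assoc]
    exact h2.trans (h1.trans (mul_le_mul_of_nonneg_left (h v) (Real.exp_pos _).le))
  exact Real.exp_le_exp.1 (le_of_mul_le_mul_right h3 (qf_pos Q' hv0))

/-- A triangle inequality up to a constant factor in one of the terms. -/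
theorem distP_le_add_mul {s : ℕ} (Q Q' R : P s) :
    distP Q' R ≤ distP Q R + Real.sqrt s * distP Q Q' := by
  obtain ⟨g, x, hx, hg, hQ, hR⟩ := exists_simultaneous_diagonal Q R
  obtain ⟨g', x', hx', hg', hQ', hR'⟩ := exists_simultaneous_diagonal Q' R
  have h1 := le_add_of_qf_le hx hx' hQ hR hQ' hR' (qf_le_exp Q' Q)
  have h2 := le_add_of_qf_le hx' hx hQ' hR' hQ hR (qf_le_exp Q Q')
  rw [distP_comm Q' Q] at h1
  -- Ordered exponents are compared one at a time, which bounds the sup norm of `x' - x`; passing to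
  -- the Euclidean norm costs `√s`.
  have h3 : Real.sqrt (∑ j, (x' j - x j) ^ 2) ≤ Real.sqrt s * distP Q Q' :=
    sqrt_sum_sq_le (x := fun j => x' j - x j)
      (fun i => abs_le.2 ⟨by linarith [h2 i], by linarith [h1 i]⟩) (distP_nonneg _ _)
  rw [distP_eq_of_gram hg' hQ' hR', distP_eq_of_gram hg hQ hR]
  have h4 := norm_add_le (WithLp.toLp 2 x : EuclideanSpace ℝ (Fin s)) (WithLp.toLp 2 (x' - x))
  rw [← WithLp.toLp_add, add_sub_cancel, EuclideanSpace.norm_eq, EuclideanSpace.norm_eq,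
    EuclideanSpace.norm_eq] at h4
  simp only [Real.norm_eq_abs, sq_abs, Pi.sub_apply] at h4
  linarith

/-- The hypothesis is tested on `g⁻¹ e_i`, the vector of the diagonalizing basis that belongs to `x
i`. -/
theorem neg_le_of_qf_le {s : ℕ} {Q R : P s} {g : Matrix (Fin s) (Fin s) ℝ} {x : Fin s → ℝ}
    (hg : IsUnit g.det) (hQ : Q.1 = gᵀ * g)
    (hR : R.1 = gᵀ * diagonal (fun i => Real.exp (x i)) * g) {C : ℝ}
    (h : ∀ v, qf Q v ≤ Real.exp C * qf R v) (i : Fin s) : -C ≤ x i := by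
  have h1 := h (g⁻¹ *ᵥ Pi.single i 1)
  rw [qf_left_of_gram hQ, qf_right_of_gram hR, mulVec_mulVec, mul_nonsing_inv _ hg, one_mulVec,
    Finset.sum_eq_single i (by intro j _ hj; simp [hj]) (by simp),
    Finset.sum_eq_single i (by intro j _ hj; simp [hj]) (by simp)] at h1
  simp only [Pi.single_eq_same, one_pow, mul_one] at h1
  rw [← Real.exp_add, Real.one_le_exp_iff] at h1
  linarith

theorem le_of_qf_le {s : ℕ} {Q R : P s} {g : Matrix (Fin s) (Fin s) ℝ} {x : Fin s → ℝ}
    (hg : IsUnit g.det) (hQ : Q.1 = gᵀ * g)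
    (hR : R.1 = gᵀ * diagonal (fun i => Real.exp (x i)) * g) {C : ℝ}
    (h : ∀ v, qf R v ≤ Real.exp C * qf Q v) (i : Fin s) : x i ≤ C := by
  have h1 := h (g⁻¹ *ᵥ Pi.single i 1)
  rw [qf_left_of_gram hQ, qf_right_of_gram hR, mulVec_mulVec, mul_nonsing_inv _ hg, one_mulVec,
    Finset.sum_eq_single i (by intro j _ hj; simp [hj]) (by simp),
    Finset.sum_eq_single i (by intro j _ hj; simp [hj]) (by simp)] at h1
  simpa using h1

theorem distP_le_of_qf_le {s : ℕ} {Q R : P s} {C : ℝ} (hC : 0 ≤ C)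
    (h1 : ∀ v, qf R v ≤ Real.exp C * qf Q v) (h2 : ∀ v, qf Q v ≤ Real.exp C * qf R v) :
    distP Q R ≤ Real.sqrt s * C := by
  obtain ⟨g, x, hx, hg, hQ, hR⟩ := exists_simultaneous_diagonal Q R
  rw [distP_eq_of_gram hg hQ hR]
  exact sqrt_sum_sq_le (fun i => abs_le.2 ⟨neg_le_of_qf_le hg hQ hR h2 i,
    le_of_qf_le hg hQ hR h1 i⟩) hC

/-! ### The vectors `v_i` and the rays `r_i`. -/

theorem sum_ite_lt_sub {s i : ℕ} (hi : i ≤ s) (a b : ℝ) :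
    ∑ j : Fin s, (if (j : ℕ) < s - i then a else b) = ((s : ℝ) - i) * a + i * b := by
  rw [Fin.sum_univ_eq_sum_range (fun n : ℕ => if n < s - i then a else b) s, Finset.sum_ite]
  have e1 : (Finset.range s).filter (fun n => n < s - i) = Finset.range (s - i) := by
    ext n; simp; omega
  have e2 : (Finset.range s).filter (fun n => ¬ n < s - i) = Finset.Ico (s - i) s := by
    ext n; simp; omega
  rw [e1, e2]
  simp [Nat.sub_sub_self hi, Nat.cast_sub hi]

theorem lam_pos {s i : ℕ} (h1 : 1 ≤ i) (hi : i < s) : 0 < lam s i := by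
  have h1' : (1 : ℝ) ≤ i := by exact_mod_cast h1
  have hi' : (i : ℝ) < s := by exact_mod_cast hi
  exact Real.sqrt_pos.2 (div_pos (by linarith) (mul_pos (by linarith) (by linarith)))

theorem mu_pos {s i : ℕ} (h1 : 1 ≤ i) (hi : i < s) : 0 < mu s i := by
  have h1' : (1 : ℝ) ≤ i := by exact_mod_cast h1
  have hi' : (i : ℝ) < s := by exact_mod_cast hi
  exact Real.sqrt_pos.2 (div_pos (by linarith) (mul_pos (by linarith) (by linarith)))

theorem lam_mul_eq {s i : ℕ} (hi : i < s) : ((s : ℝ) - i) * lam s i = i * mu s i := by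
  have h := sum_vec s i
  simp only [vec] at h
  rw [sum_ite_lt_sub hi.le] at h
  linarith

theorem sum_vec_sq {s i : ℕ} (h1 : 1 ≤ i) (hi : i < s) : ∑ j, vec s i j ^ 2 = 1 := by
  have h1' : (1 : ℝ) ≤ i := by exact_mod_cast h1
  have hi' : (i : ℝ) < s := by exact_mod_cast hi
  have h2 (j : Fin s) : vec s i j ^ 2 =
      if (j : ℕ) < s - i then lam s i ^ 2 else mu s i ^ 2 := by
    unfold vec; split_ifs <;> simp
  simp only [h2]
  rw [sum_ite_lt_sub hi.le, lam, mu, Real.sq_sqrt, Real.sq_sqrt]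
  · have : (s : ℝ) - i ≠ 0 := by linarith
    have hs : (s : ℝ) ≠ 0 := by linarith
    field_simp
    ring
  · exact div_nonneg (by linarith) (mul_nonneg (by linarith) (by linarith))
  · exact div_nonneg (by linarith) (mul_nonneg (by linarith) (by linarith))

theorem distP_diagForm {s : ℕ} (t u : Fin s → ℝ) (ht : ∑ j, t j = 0) (hu : ∑ j, u j = 0) :
    distP (diagForm t ht) (diagForm u hu) = Real.sqrt (∑ j, (u j - t j) ^ 2) := by
  refine distP_eq_of_gram (g := diagonal fun j => Real.exp (t j / 2)) (x := fun j => u j - t j)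
    ?_ ?_ ?_
  · rw [det_diagonal, isUnit_iff_ne_zero, Finset.prod_ne_zero_iff]
    exact fun i _ => (Real.exp_pos _).ne'
  · simp only [diagForm, diagonal_transpose, diagonal_mul_diagonal, ← Real.exp_add]
    congr 1; ext j; ring_nf
  · simp only [diagForm, diagonal_transpose, diagonal_mul_diagonal, ← Real.exp_add]
    congr 1; ext j; ring_nf

theorem isGeodesicRay_ray {s i : ℕ} (h1 : 1 ≤ i) (hi : i < s) :
    IsGeodesicRay distP (ray s i) := by
  intro t u _ _
  rw [ray, ray, distP_diagForm]
  have : ∑ j, (vec s i j * u - vec s i j * t) ^ 2 = (u - t) ^ 2 := by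
    simp_rw [← mul_sub, mul_pow]
    rw [← Finset.sum_mul, sum_vec_sq h1 hi, one_mul]
  rw [this, Real.sqrt_sq_eq_abs, abs_sub_comm]

theorem IsGeodesicRay.act {s : ℕ} {ρ : ℝ → P s} (h : IsGeodesicRay distP ρ)
    (g : Matrix.SpecialLinearGroup (Fin s) ℝ) :
    IsGeodesicRay distP (fun t => act (ρ t) g) := by
  intro t u ht hu
  rw [distP_act, h t u ht hu]

theorem qf_ray {s i : ℕ} (t : ℝ) (v : Fin s → ℝ) :
    qf (ray s i t) v = ∑ j, Real.exp (vec s i j * t) * v j ^ 2 := qf_diagForm _ _ _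

theorem qf_single {s : ℕ} (Q : P s) (l : Fin s) : qf Q (Pi.single l 1) = Q.1 l l := by
  simp [qf, Matrix.mulVec_single]

theorem vec_one_last (n : ℕ) : vec (n + 1) 1 (Fin.last n) = -mu (n + 1) 1 := by simp [vec]

theorem vec_one_castSucc (n : ℕ) (j : Fin n) : vec (n + 1) 1 j.castSucc = lam (n + 1) 1 := by
  simp [vec]

theorem neg_mu_le_vec {s i : ℕ} (j : Fin s) : -mu s i ≤ vec s i j := by
  unfold vec
  have h1 : 0 ≤ mu s i := Real.sqrt_nonneg _
  have h2 : 0 ≤ lam s i := Real.sqrt_nonneg _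
  split_ifs <;> linarith

theorem vec_le_lam {s i : ℕ} (j : Fin s) : vec s i j ≤ lam s i := by
  unfold vec
  have h1 : 0 ≤ mu s i := Real.sqrt_nonneg _
  have h2 : 0 ≤ lam s i := Real.sqrt_nonneg _
  split_ifs <;> linarith

/-! ### Distance from a form to the points of `r_1`. -/

theorem qf_ray_one_last (n : ℕ) (t : ℝ) :
    qf (ray (n + 1) 1 t) (Pi.single (Fin.last n) 1) = Real.exp (-mu (n + 1) 1 * t) := by
  rw [qf_single]
  simp [ray, diagForm, vec_one_last]

/-- This is `|v_1|² = n λ² + μ² = 1` with `n λ = μ`. It identifies the factor `μ⁻¹` of the Busemann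
function with the gap `λ + μ` between the two exponents. -/
theorem lam_add_mu_mul_mu {n : ℕ} (hn : 1 ≤ n) :
    (lam (n + 1) 1 + mu (n + 1) 1) * mu (n + 1) 1 = 1 := by
  have h1 := sum_vec_sq (s := n + 1) le_rfl (by omega)
  have h2 := lam_mul_eq (s := n + 1) (i := 1) (by omega)
  rw [Fin.sum_univ_castSucc] at h1
  simp only [vec_one_last, vec_one_castSucc] at h1
  simp at h1 h2
  rw [← h2] at h1 ⊢
  linarith

theorem trace_ray_inv_mul (n : ℕ) (Q : P (n + 1)) (t : ℝ) :
    ((ray (n + 1) 1 t).1⁻¹ * Q.1).trace =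
      Real.exp (-lam (n + 1) 1 * t) * ∑ j : Fin n, Q.1 j.castSucc j.castSucc +
        Real.exp (mu (n + 1) 1 * t) * Q.1 (Fin.last n) (Fin.last n) := by
  have h : (ray (n + 1) 1 t).1⁻¹ = diagonal fun j => Real.exp (-vec (n + 1) 1 j * t) := by
    apply Matrix.inv_eq_left_inv
    simp only [ray, diagForm]
    rw [diagonal_mul_diagonal, ← diagonal_one]
    congr 1; ext j; rw [← Real.exp_add, ← Real.exp_zero]; ring_nf
  rw [h, Matrix.trace, Fin.sum_univ_castSucc, Finset.mul_sum]
  simp [vec_one_last, vec_one_castSucc, diagonal_mul]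

/-- A quantitative upper bound for the distance of a point to a point of the first ray. -/
theorem distP_ray_one_sq_le {n : ℕ} (hn : 1 ≤ n) (Q : P (n + 1)) :
    ∃ T K : ℝ, 0 ≤ T ∧ ∀ t : ℝ, 0 ≤ t →
      distP Q (ray (n + 1) 1 t) ^ 2 ≤ t ^ 2 + 2 * t * ((mu (n + 1) 1)⁻¹ *
        Real.log (qf Q (Pi.single (Fin.last n) 1) +
          Real.exp (-(lam (n + 1) 1 + mu (n + 1) 1) * t) * T)) + K := by
  set lm := lam (n + 1) 1 with hlm
  set m := mu (n + 1) 1 with hm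
  set e : Fin (n + 1) → ℝ := Pi.single (Fin.last n) 1 with he
  have he0 : e ≠ 0 := by simp [he]
  set q := qf Q e with hq
  have hq0 : 0 < q := qf_pos Q he0
  have hmpos : 0 < m := mu_pos le_rfl (by omega)
  have hlpos : 0 < lm := lam_pos le_rfl (by omega)
  have hlmm : (lm + m) * m = 1 := lam_add_mu_mul_mu hn
  have hnl : (n : ℝ) * lm = m := by
    have := lam_mul_eq (s := n + 1) (i := 1) (by omega)
    simpa using this
  set T := ∑ j : Fin n, Q.1 j.castSucc j.castSucc with hT
  have hTpos : 0 < T := by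
    refine Finset.sum_pos (fun j _ => ?_) ⟨⟨0, hn⟩, Finset.mem_univ _⟩
    rw [← qf_single]
    exact qf_pos Q (by simp)
  set D := distP Q (ray (n + 1) 1 0) with hD
  set B := |Real.log T| + |Real.log q| + |Real.log (q + T)| + D with hB
  have hD0 : 0 ≤ D := distP_nonneg _ _
  refine ⟨T, ((n + 1 : ℕ) : ℝ) * B ^ 2, hTpos.le, fun t ht => ?_⟩
  obtain ⟨g, x, hx, hg, hQ, hR⟩ := exists_simultaneous_diagonal (ray (n + 1) 1 t) Q
  have hsum := sum_eq_zero_of_gram hQ hR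
  have htr := trace_eq_of_gram hg hQ hR
  rw [trace_ray_inv_mul, ← hT, ← qf_single, ← he, ← hq, ← hlm, ← hm, Fin.sum_univ_succ] at htr
  have hx0 : Real.exp (m * t) * q ≤ Real.exp (x 0) := by
    have h1 := qf_le_of_gram hQ hR (fun i => hx (Fin.zero_le i)) e
    rw [qf_ray_one_last, ← hq, ← hm] at h1
    calc _ ≤ Real.exp (m * t) * (Real.exp (x 0) * Real.exp (-m * t)) :=
          mul_le_mul_of_nonneg_left h1 (Real.exp_pos _).le
      _ = _ := by rw [← Real.exp_add, ← Real.exp_add]; ring_nf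
  -- The trace is `e^{μt} q + e^{-λt} T`, and the largest eigenvalue alone accounts for at least
  -- `e^{μt} q`, so the others share at most `e^{-λt} T`.
  have hxi (i : Fin n) : x i.succ ≤ -lm * t + Real.log T := by
    have h1 := Finset.single_le_sum (f := fun i : Fin n => Real.exp (x i.succ))
      (fun i _ => (Real.exp_pos _).le) (Finset.mem_univ i)
    rw [← Real.exp_le_exp, Real.exp_add, Real.exp_log hTpos]
    linarith
  have hxl (i : Fin (n + 1)) : -(lm * t + D) ≤ x i := by
    refine neg_le_of_qf_le hg hQ hR (fun v => ?_) i
    have h1 := qf_le_exp Q (ray (n + 1) 1 0) v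
    have h2 : qf (ray (n + 1) 1 t) v ≤ Real.exp (lm * t) * qf (ray (n + 1) 1 0) v := by
      rw [qf_ray, qf_ray, Finset.mul_sum]
      refine Finset.sum_le_sum fun j _ => ?_
      simp only [mul_zero, Real.exp_zero, one_mul]
      exact mul_le_mul_of_nonneg_right
        (Real.exp_le_exp.2 (mul_le_mul_of_nonneg_right (vec_le_lam j) ht)) (sq_nonneg _)
    rw [Real.exp_add, mul_assoc]
    exact h2.trans (mul_le_mul_of_nonneg_left h1 (Real.exp_pos _).le)
  have hqT : 0 < q + Real.exp (-(lm + m) * t) * T := by positivity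
  have hx0l : m * t + Real.log q ≤ x 0 := by
    rw [← Real.exp_le_exp, Real.exp_add, Real.exp_log hq0]; exact hx0
  have hx0u : x 0 ≤ m * t + Real.log (q + Real.exp (-(lm + m) * t) * T) := by
    rw [← Real.exp_le_exp, Real.exp_add, Real.exp_log hqT, mul_add, ← mul_assoc, ← Real.exp_add]
    have h1 : 0 ≤ ∑ i : Fin n, Real.exp (x i.succ) :=
      Finset.sum_nonneg fun i _ => (Real.exp_pos _).le
    have h2 : m * t + -(lm + m) * t = -lm * t := by ring
    rw [h2]
    linarith
  have hx0u' : x 0 ≤ m * t + Real.log (q + T) := by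
    refine hx0u.trans (add_le_add_right (Real.log_le_log hqT ?_) _)
    have : Real.exp (-(lm + m) * t) ≤ 1 := Real.exp_le_one_iff.2 (by nlinarith)
    nlinarith
  have hsum' : x 0 + ∑ i : Fin n, x i.succ = 0 := by rw [← Fin.sum_univ_succ]; exact hsum
  have hy0 : (x 0 - m * t) ^ 2 ≤ B ^ 2 := by
    apply sq_le_sq'
    · linarith [neg_abs_le (Real.log q), abs_nonneg (Real.log T), abs_nonneg (Real.log (q + T))]
    · linarith [le_abs_self (Real.log (q + T)), abs_nonneg (Real.log T), abs_nonneg (Real.log q)]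
  have hyi : ∑ i : Fin n, (x i.succ + lm * t) ^ 2 ≤ n * B ^ 2 := by
    have (i : Fin n) : (x i.succ + lm * t) ^ 2 ≤ B ^ 2 := by
      apply sq_le_sq'
      · linarith [hxl i.succ, abs_nonneg (Real.log q), abs_nonneg (Real.log T),
          abs_nonneg (Real.log (q + T))]
      · linarith [hxi i, le_abs_self (Real.log T), abs_nonneg (Real.log q),
          abs_nonneg (Real.log (q + T))]
    refine (Finset.sum_le_sum fun i _ => this i).trans ?_
    simp
  -- The squares are completed about `t v_1`, up to reordering: deviations from it are bounded, and
  -- since the exponents sum to zero the linear terms reduce to a multiple of `x 0`.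
  have hsq : ∑ i : Fin n, x i.succ ^ 2 = ∑ i : Fin n, (x i.succ + lm * t) ^ 2
      - 2 * (lm * t) * (∑ i : Fin n, x i.succ) - n * (lm * t) ^ 2 := by
    have (i : Fin n) : x i.succ ^ 2 = (x i.succ + lm * t) ^ 2 - 2 * (lm * t) * x i.succ
      - (lm * t) ^ 2 := by ring
    simp_rw [this]
    rw [Finset.sum_sub_distrib, Finset.sum_sub_distrib, ← Finset.mul_sum]
    simp
  have hinv : m⁻¹ = lm + m := (eq_inv_of_mul_eq_one_left hlmm).symm
  rw [distP_comm, distP_eq_of_gram hg hQ hR, Real.sq_sqrt (Finset.sum_nonneg fun _ _ => sq_nonneg _),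
    Fin.sum_univ_succ, hsq, hinv]
  have hS : ∑ i : Fin n, x i.succ = - x 0 := by linarith
  rw [hS]
  push_cast
  have h6 : t * (lm + m) * (x 0 - m * t) ≤
      t * (lm + m) * Real.log (q + Real.exp (-(lm + m) * t) * T) :=
    mul_le_mul_of_nonneg_left (by linarith) (by positivity)
  have h7 : (n : ℝ) * (lm * t) ^ 2 = m * lm * t ^ 2 := by rw [← hnl]; ring
  have h8 : lm * m * t ^ 2 + m ^ 2 * t ^ 2 = t ^ 2 := by linear_combination t ^ 2 * hlmm
  rw [h7]
  nlinarith

/-- `qf_le_exp_mu` is applied to the last basis vector, on which `r_1(t)` is exactly `e^{-μt}`;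
dividing by the sharp constant `μ` gives slope one in `t`. -/
theorem le_distP_ray_one {n : ℕ} (hn : 1 ≤ n) (Q : P (n + 1))
    (γ : Matrix.SpecialLinearGroup (Fin (n + 1)) ℝ) (t : ℝ) :
    t + (mu (n + 1) 1)⁻¹ * Real.log (qf Q (γ.1 *ᵥ Pi.single (Fin.last n) 1)) ≤
      distP (act Q γ) (ray (n + 1) 1 t) := by
  have hm : 0 < mu (n + 1) 1 := mu_pos le_rfl (by omega)
  have h := qf_le_exp_mu (ray (n + 1) 1 t) (act Q γ) (Pi.single (Fin.last n) 1)
  have hq : 0 < qf (act Q γ) (Pi.single (Fin.last n) 1) := qf_pos _ (by simp)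
  rw [qf_ray_one_last, ← Real.exp_add, ← Real.log_le_iff_le_exp hq] at h
  rw [qf_act, distP_comm] at h
  have h2 := mul_le_mul_of_nonneg_left h (inv_pos.2 hm).le
  have h3 : (mu (n + 1) 1)⁻¹ * (mu (n + 1) 1 * distP (act Q γ) (ray (n + 1) 1 t) +
      -mu (n + 1) 1 * t) = distP (act Q γ) (ray (n + 1) 1 t) - t := by
    field_simp
    ring
  linarith

/-- An upper bound of `distP Q (ray t) - t` tending to the value of the Busemann function. -/
theorem exists_tendsto_distP_ray_one_sub_le {n : ℕ} (hn : 1 ≤ n) (Q : P (n + 1)) :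
    ∃ f : ℝ → ℝ, Tendsto f atTop
        (𝓝 ((mu (n + 1) 1)⁻¹ * Real.log (qf Q (Pi.single (Fin.last n) 1)))) ∧
      ∀ᶠ t in atTop, distP Q (ray (n + 1) 1 t) - t ≤ f t := by
  obtain ⟨T, K, hT, h⟩ := distP_ray_one_sq_le hn Q
  set m := mu (n + 1) 1 with hm
  set q := qf Q (Pi.single (Fin.last n) 1) with hq
  have hq0 : 0 < q := qf_pos Q (by simp)
  have hc : 0 < lam (n + 1) 1 + m := add_pos (lam_pos le_rfl (by omega)) (mu_pos le_rfl (by omega))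
  set b : ℝ → ℝ := fun t => m⁻¹ * Real.log (q + Real.exp (-(lam (n + 1) 1 + m) * t) * T) with hb
  have hbt : Tendsto b atTop (𝓝 (m⁻¹ * Real.log q)) := by
    apply Tendsto.const_mul
    have h1 : Tendsto (fun t : ℝ => Real.exp (-(lam (n + 1) 1 + m) * t)) atTop (𝓝 0) :=
      Real.tendsto_exp_atBot.comp (tendsto_id.const_mul_atTop_of_neg (by linarith))
    have h2 := (h1.mul_const T).const_add q
    rw [zero_mul, add_zero] at h2
    exact h2.log hq0.ne'
  have hat : Tendsto (fun t => t + b t) atTop atTop := tendsto_id.atTop_add hbt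
  -- The correction `|K| / (t + b)` tends to zero, and the square of `(t + b) + |K| / (t + b)`
  -- exceeds `t² + 2tb + K`.
  refine ⟨fun t => b t + |K| / (t + b t), ?_, ?_⟩
  · have := hbt.add (tendsto_const_nhds.div_atTop hat (a := |K|))
    rwa [add_zero] at this
  · filter_upwards [eventually_ge_atTop 0, hat.eventually_gt_atTop 0] with t ht ha
    have h1 := h t ht
    have h2 : distP Q (ray (n + 1) 1 t) ≤ (t + b t) + |K| / (t + b t) := by
      apply le_of_sq_le_sq _ (by positivity)
      have h3 : ((t + b t) + |K| / (t + b t)) ^ 2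
          = (t + b t) ^ 2 + 2 * |K| + (|K| / (t + b t)) ^ 2 := by
        field_simp
        ring
      rw [h3]
      refine h1.trans ?_
      change t ^ 2 + 2 * t * b t + K ≤ _
      nlinarith [le_abs_self K, sq_nonneg (b t), sq_nonneg (|K| / (t + b t)), abs_nonneg K]
    linarith

/-! ### Minima over lattice orbits and the Busemann function on the quotient. -/

/-- The integral vectors on which a positive definite form is bounded are finite in number. -/
theorem finite_qf_le {s : ℕ} (Q : P s) (C : ℝ) :
    {v : Fin s → ℤ | qf Q (fun i => (v i : ℝ)) ≤ C}.Finite := by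
  set I : P s := diagForm 0 (by simp) with hI
  set M := Real.exp (distP Q I) * C
  refine (Set.finite_Icc (fun _ : Fin s => -⌈|M| + 1⌉) (fun _ => ⌈|M| + 1⌉)).subset fun v hv => ?_
  have h1 : ∑ i, (v i : ℝ) ^ 2 ≤ |M| := by
    have h2 := qf_le_exp Q I (fun i => (v i : ℝ))
    rw [hI, qf_diagForm] at h2
    simp only [Pi.zero_apply, Real.exp_zero, one_mul] at h2
    exact (h2.trans (mul_le_mul_of_nonneg_left hv (Real.exp_pos _).le)).trans (le_abs_self _)
  have h3 (i : Fin s) : |(v i : ℝ)| ≤ |M| + 1 := by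
    have h4 := (Finset.single_le_sum (f := fun i => (v i : ℝ) ^ 2) (fun _ _ => sq_nonneg _)
      (Finset.mem_univ i)).trans h1
    simp only [← sq_abs (v i : ℝ)] at h4
    nlinarith [sq_nonneg (|(v i : ℝ)| - 1)]
  constructor
  · intro i
    have h5 := (neg_le_of_abs_le (h3 i))
    have h6 := Int.le_ceil (|M| + 1)
    have : ((-⌈|M| + 1⌉ : ℤ) : ℝ) ≤ v i := by push_cast; linarith
    exact_mod_cast this
  · intro i
    have : (v i : ℝ) ≤ ⌈|M| + 1⌉ := (le_of_abs_le (h3 i)).trans (Int.le_ceil _)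
    exact_mod_cast this

theorem toReal_mulVec_single {s : ℕ} (γ : Matrix.SpecialLinearGroup (Fin s) ℤ) (l : Fin s) :
    (toReal γ).1 *ᵥ Pi.single l 1 = fun i => (γ.1 i l : ℝ) := by
  ext i
  simp [toReal, Matrix.mulVec_single]

/-- The values of `Q` on the `SL(s, ℤ)`-orbit of a basis vector attain a minimum. -/
theorem exists_minimizer {s : ℕ} (Q : P s) (l : Fin s) :
    ∃ γ : Matrix.SpecialLinearGroup (Fin s) ℤ, ∀ γ' : Matrix.SpecialLinearGroup (Fin s) ℤ,
      qf Q ((toReal γ).1 *ᵥ Pi.single l 1) ≤ qf Q ((toReal γ').1 *ᵥ Pi.single l 1) := by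
  simp only [toReal_mulVec_single]
  -- Only orbit vectors doing at least as well as `γ = 1` compete, and these are finite in number.
  let S : Set (Fin s → ℤ) := {v | qf Q (fun i => (v i : ℝ)) ≤
    qf Q (fun i => (((1 : Matrix.SpecialLinearGroup (Fin s) ℤ).1 i l : ℤ) : ℝ))} ∩
      Set.range fun γ : Matrix.SpecialLinearGroup (Fin s) ℤ => fun i => γ.1 i l
  obtain ⟨v, ⟨hv1, γ, rfl⟩, hv⟩ := Set.exists_min_image S (fun v => qf Q (fun i => (v i : ℝ)))
    ((finite_qf_le Q _).inter_of_left _) ⟨_, le_refl (qf Q _), 1, rfl⟩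
  refine ⟨γ, fun γ' => ?_⟩
  rcases le_total (qf Q (fun i => (γ'.1 i l : ℝ)))
    (qf Q (fun i => (((1 : Matrix.SpecialLinearGroup (Fin s) ℤ).1 i l : ℤ) : ℝ))) with h | h
  · exact hv _ ⟨h, γ', rfl⟩
  · exact le_trans hv1 h

theorem proj_eq_proj {s : ℕ} {Q₁ Q₂ : P s} :
    proj Q₁ = proj Q₂ ↔ ∃ B : Matrix.SpecialLinearGroup (Fin s) ℤ, Q₁ = act Q₂ (toReal B) :=
  ⟨fun h => Quotient.exact h, fun h => Quotient.sound h⟩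

theorem toReal_mul {s : ℕ} (A B : Matrix.SpecialLinearGroup (Fin s) ℤ) :
    toReal (A * B) = toReal A * toReal B := map_mul _ _ _

theorem toReal_inv {s : ℕ} (A : Matrix.SpecialLinearGroup (Fin s) ℤ) :
    toReal A⁻¹ = (toReal A)⁻¹ := by simp [toReal]

theorem toReal_one {s : ℕ} : toReal (1 : Matrix.SpecialLinearGroup (Fin s) ℤ) = 1 := by
  simp [toReal]

theorem distT_le {s : ℕ} (Q R : P s) (γ : Matrix.SpecialLinearGroup (Fin s) ℤ) :
    distT (proj Q) (proj R) ≤ distP (act Q (toReal γ)) R := by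
  refine csInf_le ⟨0, ?_⟩ ⟨_, _, proj_eq_proj.2 ⟨γ, rfl⟩, rfl, rfl⟩
  rintro _ ⟨Q₁, Q₂, -, -, rfl⟩
  exact distP_nonneg _ _

/-- Since `SL(s, ℤ)` acts by isometries, the representative of the second point may be kept fixed.
-/
theorem le_distT {s : ℕ} {Q R : P s} {c : ℝ}
    (h : ∀ γ : Matrix.SpecialLinearGroup (Fin s) ℤ, c ≤ distP (act Q (toReal γ)) R) :
    c ≤ distT (proj Q) (proj R) := by
  refine le_csInf ⟨_, Q, R, rfl, rfl, rfl⟩ ?_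
  rintro _ ⟨Q₁, Q₂, h1, h2, rfl⟩
  obtain ⟨A, rfl⟩ := proj_eq_proj.1 h1
  obtain ⟨B, rfl⟩ := proj_eq_proj.1 h2
  rw [← distP_act _ _ (toReal B⁻¹), ← act_mul, ← act_mul, ← toReal_mul, ← toReal_mul,
    mul_inv_cancel, toReal_one, act_one]
  exact h _

/-- The Busemann function of the first ray, by the minimum of the form on an orbit. -/
theorem fbar_one_eq {n : ℕ} (hn : 1 ≤ n) (Q : P (n + 1))
    {γ : Matrix.SpecialLinearGroup (Fin (n + 1)) ℤ}
    (hγ : ∀ γ' : Matrix.SpecialLinearGroup (Fin (n + 1)) ℤ,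
      qf Q ((toReal γ).1 *ᵥ Pi.single (Fin.last n) 1) ≤
        qf Q ((toReal γ').1 *ᵥ Pi.single (Fin.last n) 1)) :
    fbar (n + 1) 1 (proj Q) =
      (mu (n + 1) 1)⁻¹ * Real.log (qf Q ((toReal γ).1 *ᵥ Pi.single (Fin.last n) 1)) := by
  have hm : 0 < mu (n + 1) 1 := mu_pos le_rfl (by omega)
  apply Tendsto.limUnder_eq
  obtain ⟨f, hf, hle⟩ := exists_tendsto_distP_ray_one_sub_le hn (act Q (toReal γ))
  rw [qf_act] at hf
  -- Squeeze: the lower bound is constant and holds for every representative, the upper bound uses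
  -- the minimizing one.
  refine tendsto_of_tendsto_of_tendsto_of_le_of_le' tendsto_const_nhds hf
    (Eventually.of_forall fun t => ?_) ?_
  · rw [le_sub_iff_add_le']
    refine le_distT fun γ' => le_trans ?_ (le_distP_ray_one hn Q (toReal γ') t)
    refine add_le_add_right (mul_le_mul_of_nonneg_left ?_ (inv_pos.2 hm).le) _
    exact Real.log_le_log (by rw [← qf_act]; exact qf_pos _ (by simp)) (hγ γ')
  · filter_upwards [hle] with t ht
    exact (sub_le_sub_right (distT_le _ _ γ) t).trans ht

theorem exists_fbar_one_eq {n : ℕ} (hn : 1 ≤ n) (Q : P (n + 1)) :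
    ∃ γ : Matrix.SpecialLinearGroup (Fin (n + 1)) ℤ, fbar (n + 1) 1 (proj Q) =
      (mu (n + 1) 1)⁻¹ * Real.log (qf Q ((toReal γ).1 *ᵥ Pi.single (Fin.last n) 1)) := by
  obtain ⟨γ, hγ⟩ := exists_minimizer Q (Fin.last n)
  exact ⟨γ, fbar_one_eq hn Q hγ⟩

theorem qf_orbit_pos {s : ℕ} (Q : P s) (g : Matrix.SpecialLinearGroup (Fin s) ℝ) (l : Fin s) :
    0 < qf Q (g.1 *ᵥ Pi.single l 1) := by
  rw [← qf_act]; exact qf_pos _ (by simp)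

theorem fbar_one_le {n : ℕ} (hn : 1 ≤ n) (Q : P (n + 1))
    (γ : Matrix.SpecialLinearGroup (Fin (n + 1)) ℤ) : fbar (n + 1) 1 (proj Q) ≤
      (mu (n + 1) 1)⁻¹ * Real.log (qf Q ((toReal γ).1 *ᵥ Pi.single (Fin.last n) 1)) := by
  have hm : 0 < mu (n + 1) 1 := mu_pos le_rfl (by omega)
  obtain ⟨γ', hγ'⟩ := exists_minimizer Q (Fin.last n)
  rw [fbar_one_eq hn Q hγ']
  exact mul_le_mul_of_nonneg_left (Real.log_le_log (qf_orbit_pos _ _ _) (hγ' γ)) (inv_pos.2 hm).le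

/-- The minimizing vector for `Q` is tried on `R`; its value grows by at most `e^{μ d}`, and the
factor `μ⁻¹` cancels `μ`. -/
theorem fbar_one_le_add_distP {n : ℕ} (hn : 1 ≤ n) (Q R : P (n + 1)) :
    fbar (n + 1) 1 (proj R) ≤ fbar (n + 1) 1 (proj Q) + distP Q R := by
  have hm : 0 < mu (n + 1) 1 := mu_pos le_rfl (by omega)
  obtain ⟨γ, hγ⟩ := exists_fbar_one_eq hn Q
  have h1 := Real.log_le_log (qf_orbit_pos _ _ _)
    (qf_le_exp_mu Q R ((toReal γ).1 *ᵥ Pi.single (Fin.last n) 1))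
  rw [Real.log_mul (Real.exp_pos _).ne' (qf_orbit_pos _ _ _).ne', Real.log_exp] at h1
  have h2 := mul_le_mul_of_nonneg_left h1 (inv_pos.2 hm).le
  rw [mul_add, inv_mul_cancel_left₀ hm.ne', ← hγ] at h2
  linarith [fbar_one_le hn R γ]

/-! ### Asymptotic rays and the speed of ascent along translates of `r_m`. -/

theorem Asymptotic.exists_distP_le {s : ℕ} {ρ σ : ℝ → P s} (hρ : IsGeodesicRay distP ρ)
    (hσ : IsGeodesicRay distP σ) (h : Asymptotic distP ρ σ) :
    ∃ C, ∀ t, 0 ≤ t → distP (ρ t) (σ t) ≤ C := by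
  obtain ⟨C, h1, -⟩ := h
  set r := Real.sqrt s with hr
  have hr0 : 0 ≤ r := Real.sqrt_nonneg _
  refine ⟨r * distP (ρ 0) (σ 0) + r * C + r * C, fun t ht => ?_⟩
  obtain ⟨u, hu, hd⟩ := h1 t ht
  have hd' : r * distP (ρ t) (σ u) ≤ r * C := mul_le_mul_of_nonneg_left hd hr0
  have a1 := hρ t 0 ht le_rfl
  have a2 := hσ u 0 hu le_rfl
  have a3 := hσ u t hu ht
  rw [sub_zero, abs_of_nonneg ht] at a1
  rw [sub_zero, abs_of_nonneg hu] at a2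
  -- Distances to the starting points bound `|u - t|`. In each use of the weak triangle inequality
  -- the factor `√s` falls on a term already known to be bounded.
  have b1 := distP_le_add_mul (σ u) (ρ t) (σ 0)
  have b2 := distP_le_add_mul (σ 0) (ρ 0) (ρ t)
  have b3 := distP_le_add_mul (ρ t) (σ u) (ρ 0)
  have b4 := distP_le_add_mul (ρ 0) (σ 0) (σ u)
  have b5 := distP_le_add_mul (σ u) (ρ t) (σ t)
  rw [distP_comm (σ 0) (ρ 0), distP_comm (ρ 0) (ρ t), distP_comm (σ 0) (ρ t)] at b2
  rw [distP_comm (σ 0) (σ u), distP_comm (ρ 0) (σ u)] at b4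
  rw [distP_comm (σ u) (ρ t)] at b1 b5
  have hab : |u - t| ≤ r * distP (ρ 0) (σ 0) + r * C := abs_le.2 ⟨by linarith, by linarith⟩
  linarith

theorem asymptotic_of_distP_le {s : ℕ} {ρ σ : ℝ → P s} {C : ℝ}
    (h : ∀ t, 0 ≤ t → distP (ρ t) (σ t) ≤ C) : Asymptotic distP ρ σ :=
  ⟨C, fun t ht => ⟨t, ht, h t ht⟩, fun t ht => ⟨t, ht, h t ht⟩⟩

/-- All entries of `v_1` but the last equal `λ_1`, and `v_m` has sum zero, so the product is `(λ_1 +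
μ_1) μ_m`. The speed is thus the decay rate `μ_m` rescaled by `μ_1⁻¹`. -/
theorem alpha_one {n m : ℕ} (hn : 1 ≤ n) (hm : 1 ≤ m) :
    alpha (n + 1) m 1 = mu (n + 1) m * (mu (n + 1) 1)⁻¹ := by
  have h1 := sum_vec (n + 1) m
  have h2 : vec (n + 1) m (Fin.last n) = -mu (n + 1) m := by
    simp only [vec, Fin.val_last]
    rw [if_neg (by omega)]
  rw [Fin.sum_univ_castSucc, h2] at h1
  rw [alpha, dotProduct, Fin.sum_univ_castSucc, h2, vec_one_last]
  simp only [vec_one_castSucc]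
  rw [← Finset.mul_sum, ← eq_inv_of_mul_eq_one_left (lam_add_mu_mul_mu hn)]
  linear_combination (lam (n + 1) 1) * h1

/-- `-μ_m` is the smallest exponent of `r_m`. This caps the ascent; vectors supported on the last
`m` coordinates attain the bound (`exp_mul_qf_ray_zero_eq`). -/
theorem exp_mul_qf_ray_zero_le {s m : ℕ} {t : ℝ} (ht : 0 ≤ t) (v : Fin s → ℝ) :
    Real.exp (-mu s m * t) * qf (ray s m 0) v ≤ qf (ray s m t) v := by
  rw [qf_ray, qf_ray, Finset.mul_sum]
  refine Finset.sum_le_sum fun j _ => ?_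
  simp only [mul_zero, Real.exp_zero, one_mul]
  exact mul_le_mul_of_nonneg_right
    (Real.exp_le_exp.2 (mul_le_mul_of_nonneg_right (neg_mu_le_vec j) ht)) (sq_nonneg _)

theorem exp_mul_qf_ray_zero_eq {s m : ℕ} (t : ℝ) {v : Fin s → ℝ}
    (hv : ∀ i : Fin s, (i : ℕ) < s - m → v i = 0) :
    qf (ray s m t) v = Real.exp (-mu s m * t) * qf (ray s m 0) v := by
  rw [qf_ray, qf_ray, Finset.mul_sum]
  refine Finset.sum_congr rfl fun j _ => ?_
  by_cases hj : (j : ℕ) < s - m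
  · simp [hv j hj]
  · simp [vec, hj]

/-- No translate of the ray `r_m` ascends faster than with speed `α_1`. -/
theorem neg_fbar_one_ray_le {n m : ℕ} (hn : 1 ≤ n) (hm : 1 ≤ m)
    (g : Matrix.SpecialLinearGroup (Fin (n + 1)) ℝ) {t : ℝ} (ht : 0 ≤ t) :
    -fbar (n + 1) 1 (proj (act (ray (n + 1) m t) g)) ≤
      alpha (n + 1) m 1 * t - fbar (n + 1) 1 (proj (act (ray (n + 1) m 0) g)) := by
  have hmu : 0 < mu (n + 1) 1 := mu_pos le_rfl (by omega)
  obtain ⟨γ, hγ⟩ := exists_fbar_one_eq hn (act (ray (n + 1) m t) g)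
  have h1 := fbar_one_le hn (act (ray (n + 1) m 0) g) γ
  have h0 := qf_orbit_pos (act (ray (n + 1) m 0) g) (toReal γ) (Fin.last n)
  have h2 := exp_mul_qf_ray_zero_le (s := n + 1) (m := m) ht
    (g.1 *ᵥ (toReal γ).1 *ᵥ Pi.single (Fin.last n) 1)
  rw [← qf_act _ g, ← qf_act _ g] at h2
  have h3 := Real.log_le_log (mul_pos (Real.exp_pos _) h0) h2
  rw [Real.log_mul (Real.exp_pos _).ne' h0.ne', Real.log_exp] at h3
  have h4 := mul_le_mul_of_nonneg_left h3 (inv_pos.2 hmu).le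
  rw [← hγ, mul_add] at h4
  rw [alpha_one hn hm]
  linarith

/-- A translate of `r_m` that meets a lattice vector at infinity ascends with speed `α_1`. -/
theorem le_neg_fbar_one_ray {n m : ℕ} (hn : 1 ≤ n) (hm : 1 ≤ m)
    (g : Matrix.SpecialLinearGroup (Fin (n + 1)) ℝ)
    {γ : Matrix.SpecialLinearGroup (Fin (n + 1)) ℤ}
    (hγ : ∀ i : Fin (n + 1), (i : ℕ) < n + 1 - m →
      (g.1 *ᵥ (toReal γ).1 *ᵥ Pi.single (Fin.last n) 1) i = 0) :
    ∃ C, ∀ t, alpha (n + 1) m 1 * t + C ≤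
      -fbar (n + 1) 1 (proj (act (ray (n + 1) m t) g)) := by
  have h0 := qf_orbit_pos (act (ray (n + 1) m 0) g) (toReal γ) (Fin.last n)
  refine ⟨-((mu (n + 1) 1)⁻¹ * Real.log (qf (act (ray (n + 1) m 0) g)
    ((toReal γ).1 *ᵥ Pi.single (Fin.last n) 1))), fun t => ?_⟩
  have h1 := fbar_one_le hn (act (ray (n + 1) m t) g) γ
  have h2 := exp_mul_qf_ray_zero_eq t hγ
  rw [← qf_act _ g, ← qf_act _ g] at h2
  rw [h2, Real.log_mul (Real.exp_pos _).ne' h0.ne', Real.log_exp] at h1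
  rw [alpha_one hn hm]
  linarith

/-- A translate of `r_m` that ascends with speed `α_1` infinitely often meets a lattice vector at
infinity. -/
theorem exists_orbit_mem_of_frequently {n m : ℕ} (hn : 1 ≤ n) (hm : 1 ≤ m) (hmn : m < n + 1)
    (g : Matrix.SpecialLinearGroup (Fin (n + 1)) ℝ) {C : ℝ}
    (h : ∃ᶠ t in atTop, alpha (n + 1) m 1 * t + C ≤
      -fbar (n + 1) 1 (proj (act (ray (n + 1) m t) g))) :
    ∃ γ : Matrix.SpecialLinearGroup (Fin (n + 1)) ℤ, ∀ i : Fin (n + 1), (i : ℕ) < n + 1 - m →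
      (g.1 *ᵥ (toReal γ).1 *ᵥ Pi.single (Fin.last n) 1) i = 0 := by
  have hmu : 0 < mu (n + 1) 1 := mu_pos le_rfl (by omega)
  have hlm : 0 < lam (n + 1) m := lam_pos hm hmn
  set R := Real.exp (-(mu (n + 1) 1 * C)) with hR
  have key (t : ℝ) (ht : alpha (n + 1) m 1 * t + C ≤
      -fbar (n + 1) 1 (proj (act (ray (n + 1) m t) g))) :
      ∃ γ : Matrix.SpecialLinearGroup (Fin (n + 1)) ℤ, qf (act (ray (n + 1) m t) g)
        ((toReal γ).1 *ᵥ Pi.single (Fin.last n) 1) ≤ Real.exp (-mu (n + 1) m * t) * R := by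
    obtain ⟨γ, hγ⟩ := exists_fbar_one_eq hn (act (ray (n + 1) m t) g)
    refine ⟨γ, ?_⟩
    rw [hγ, alpha_one hn hm] at ht
    rw [hR, ← Real.exp_add, ← Real.log_le_iff_le_exp (qf_orbit_pos _ _ _)]
    have h2 := mul_le_mul_of_nonneg_left ht hmu.le
    have h3 : mu (n + 1) 1 * (mu (n + 1) m * (mu (n + 1) 1)⁻¹ * t + C) =
      mu (n + 1) m * t + mu (n + 1) 1 * C := by field_simp
    rw [h3, mul_neg, mul_inv_cancel_left₀ hmu.ne'] at h2
    linarith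
  set F : Set (Fin (n + 1) → ℤ) := {v | qf (act (ray (n + 1) m 0) g) (fun i => (v i : ℝ)) ≤ R} ∩
    Set.range fun γ : Matrix.SpecialLinearGroup (Fin (n + 1)) ℤ => fun i => γ.1 i (Fin.last n)
    with hF
  have hFfin : F.Finite := (finite_qf_le _ R).inter_of_left _
  -- A vector with value at most `R e^{-μt}` at time `t` had value at most `R` at time 0, since
  -- nothing decays faster. So all candidates lie in the finite set `F`, and one of them recurs.
  have hfr : ∃ᶠ t in atTop, ∃ v ∈ F, qf (act (ray (n + 1) m t) g) (fun i => (v i : ℝ)) ≤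
      Real.exp (-mu (n + 1) m * t) * R := by
    refine (h.and_eventually (eventually_ge_atTop 0)).mono fun t ⟨ht, ht0⟩ => ?_
    obtain ⟨γ, hγ⟩ := key t ht
    rw [toReal_mulVec_single] at hγ
    refine ⟨_, ⟨?_, γ, rfl⟩, hγ⟩
    have h2 := exp_mul_qf_ray_zero_le (s := n + 1) (m := m) ht0
      (g.1 *ᵥ fun i => (γ.1 i (Fin.last n) : ℝ))
    rw [← qf_act _ g, ← qf_act _ g] at h2
    exact le_of_mul_le_mul_left (h2.trans hγ) (Real.exp_pos _)
  obtain ⟨v, hvF, hv⟩ := (frequently_exists_finite hFfin).1 hfr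
  obtain ⟨-, γ, hγ⟩ := hvF
  refine ⟨γ, fun i hi => ?_⟩
  rw [toReal_mulVec_single]
  by_contra hne
  set w := g.1 *ᵥ fun i => (γ.1 i (Fin.last n) : ℝ) with hw
  -- A nonzero component in a growing direction would push the value of the recurring vector past
  -- `R`.
  have htend : Tendsto (fun t : ℝ => Real.exp (lam (n + 1) m * t) * w i ^ 2) atTop atTop :=
    (Real.tendsto_exp_atTop.comp (tendsto_id.const_mul_atTop hlm)).atTop_mul_const (by positivity)
  obtain ⟨t, ht, ht1, ht2⟩ :=
    (hv.and_eventually ((htend.eventually_gt_atTop R).and (eventually_ge_atTop 0))).exists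
  rw [← hγ, qf_act, qf_ray] at ht
  have h5 := (Finset.single_le_sum (fun j _ => by positivity) (Finset.mem_univ i)).trans ht
  have h6 : vec (n + 1) m i = lam (n + 1) m := by simp [vec, hi]
  rw [← hw, h6] at h5
  have h7 : Real.exp (-mu (n + 1) m * t) ≤ 1 := by
    rw [Real.exp_le_one_iff]
    have := mu_pos hm hmn
    nlinarith
  have h8 : 0 < R := Real.exp_pos _
  nlinarith

/-! ### Parabolic subgroups, rotations and Weyl chambers. -/

/-- Translates of `r_m` by elements of the parabolic subgroup of `r_m` stay at bounded distance. -/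
theorem exists_qf_ray_mulVec_le {s m : ℕ} (p : Matrix (Fin s) (Fin s) ℝ)
    (hp : ∀ i j : Fin s, (i : ℕ) < s - m → s - m ≤ (j : ℕ) → p i j = 0) :
    ∃ K : ℝ, 0 ≤ K ∧ ∀ t, 0 ≤ t → ∀ v, qf (ray s m t) (p *ᵥ v) ≤ Real.exp K * qf (ray s m t) v := by
  set K := (s : ℝ) * ∑ i, ∑ j, p i j ^ 2 with hK
  have hK0 : 0 ≤ K := by positivity
  refine ⟨K, hK0, fun t ht v => ?_⟩
  have hexp : K ≤ Real.exp K := by linarith [Real.add_one_le_exp K]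
  refine le_trans ?_ (mul_le_mul_of_nonneg_right hexp (qf_nonneg _ _))
  -- The exponent of row `i` exceeds that of column `j` only on the block where `p` vanishes.
  have h1 (i j : Fin s) : Real.exp (vec s m i * t) * p i j ^ 2 ≤
      Real.exp (vec s m j * t) * p i j ^ 2 := by
    by_cases hij : (i : ℕ) < s - m ∧ s - m ≤ (j : ℕ)
    · simp [hp i j hij.1 hij.2]
    · refine mul_le_mul_of_nonneg_right (Real.exp_le_exp.2
        (mul_le_mul_of_nonneg_right ?_ ht)) (sq_nonneg _)
      by_cases hj : (j : ℕ) < s - m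
      · calc _ ≤ lam s m := vec_le_lam i
          _ = _ := by simp [vec, hj]
      · have hi : ¬ (i : ℕ) < s - m := fun hi => hij ⟨hi, not_lt.1 hj⟩
        simp [vec, hi, hj]
  have h2 (i : Fin s) : (p *ᵥ v) i ^ 2 ≤ s * ∑ j, p i j ^ 2 * v j ^ 2 := by
    have := sq_sum_le_card_mul_sum_sq (s := Finset.univ) (f := fun j => p i j * v j)
    simpa [mulVec, dotProduct, mul_pow] using this
  rw [qf_ray, qf_ray]
  calc ∑ i, Real.exp (vec s m i * t) * (p *ᵥ v) i ^ 2
      ≤ ∑ i, Real.exp (vec s m i * t) * (s * ∑ j, p i j ^ 2 * v j ^ 2) :=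
        Finset.sum_le_sum fun i _ => mul_le_mul_of_nonneg_left (h2 i) (Real.exp_pos _).le
    _ = s * ∑ i, ∑ j, (Real.exp (vec s m i * t) * p i j ^ 2) * v j ^ 2 := by
        simp only [Finset.mul_sum]
        exact Finset.sum_congr rfl fun i _ => Finset.sum_congr rfl fun j _ => by ring
    _ ≤ s * ∑ i, ∑ j, p i j ^ 2 * ∑ l, Real.exp (vec s m l * t) * v l ^ 2 := by
        refine mul_le_mul_of_nonneg_left (Finset.sum_le_sum fun i _ =>
          Finset.sum_le_sum fun j _ => ?_) (by positivity)
        calc _ ≤ Real.exp (vec s m j * t) * p i j ^ 2 * v j ^ 2 :=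
              mul_le_mul_of_nonneg_right (h1 i j) (sq_nonneg _)
          _ = p i j ^ 2 * (Real.exp (vec s m j * t) * v j ^ 2) := by ring
          _ ≤ _ := mul_le_mul_of_nonneg_left (Finset.single_le_sum
              (f := fun l => Real.exp (vec s m l * t) * v l ^ 2) (fun l _ => by positivity)
              (Finset.mem_univ j)) (sq_nonneg _)
    _ = _ := by
        rw [hK, mul_assoc, Finset.sum_mul]
        simp only [Finset.sum_mul]

/-- Writing `h v = (h g⁻¹)(g v)`, and the same with `g` and `h` exchanged, each parabolic hypothesis
gives one of the two dominations. -/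
theorem exists_distP_act_ray_le {s m : ℕ} (g h : Matrix.SpecialLinearGroup (Fin s) ℝ)
    (h1 : ∀ i j : Fin s, (i : ℕ) < s - m → s - m ≤ (j : ℕ) → (g * h⁻¹).1 i j = 0)
    (h2 : ∀ i j : Fin s, (i : ℕ) < s - m → s - m ≤ (j : ℕ) → (h * g⁻¹).1 i j = 0) :
    ∃ C, ∀ t, 0 ≤ t → distP (act (ray s m t) g) (act (ray s m t) h) ≤ C := by
  obtain ⟨K1, hK1, hb1⟩ := exists_qf_ray_mulVec_le _ h1
  obtain ⟨K2, hK2, hb2⟩ := exists_qf_ray_mulVec_le _ h2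
  refine ⟨Real.sqrt s * (K1 + K2), fun t ht => distP_le_of_qf_le (by linarith) ?_ ?_⟩
  · intro v
    rw [qf_act, qf_act]
    have := hb2 t ht (g.1 *ᵥ v)
    rw [mulVec_mulVec, ← Matrix.SpecialLinearGroup.coe_mul, inv_mul_cancel_right] at this
    exact this.trans (mul_le_mul_of_nonneg_right (Real.exp_le_exp.2 (by linarith)) (qf_nonneg _ _))
  · intro v
    rw [qf_act, qf_act]
    have := hb1 t ht (h.1 *ᵥ v)
    rw [mulVec_mulVec, ← Matrix.SpecialLinearGroup.coe_mul, inv_mul_cancel_right] at this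
    exact this.trans (mul_le_mul_of_nonneg_right (Real.exp_le_exp.2 (by linarith)) (qf_nonneg _ _))

theorem euclidean_inner_eq_sum {s : ℕ} (x y : EuclideanSpace ℝ (Fin s)) :
    inner ℝ x y = ∑ l, x l * y l := by
  simp [PiLp.inner_apply, mul_comm]

/-- The orthonormal basis adapted to the flag `⟨e_last⟩ ≤ G⁻¹ ⟨e_i ; i ≥ d⟩`, as the rows of a
rotation. -/
theorem exists_rotation {n d : ℕ} (hd : d ≤ n) (G : Matrix.SpecialLinearGroup (Fin (n + 1)) ℝ)
    (hG : ∀ i : Fin (n + 1), (i : ℕ) < d → G.1 i (Fin.last n) = 0) :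
    ∃ q : Matrix.SpecialLinearGroup (Fin (n + 1)) ℝ, q.1 * q.1ᵀ = 1 ∧
      (∀ i, i ≠ Fin.last n → q.1 i (Fin.last n) = 0) ∧
      (∀ i j : Fin (n + 1), (i : ℕ) < d → d ≤ (j : ℕ) → (G * q⁻¹).1 i j = 0) ∧
      (∀ i j : Fin (n + 1), (i : ℕ) < d → d ≤ (j : ℕ) → (q * G⁻¹).1 i j = 0) := by
  let r : Fin d → EuclideanSpace ℝ (Fin (n + 1)) := fun i => WithLp.toLp 2 (G.1 (Fin.castLE (by omega) i))
  have hr : LinearIndependent ℝ r := by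
    have h1 : LinearIndependent ℝ G.1.row := by
      rw [Matrix.linearIndependent_rows_iff_isUnit, Matrix.isUnit_iff_isUnit_det, G.2]
      exact isUnit_one
    have h2 := h1.comp (Fin.castLE (show d ≤ n + 1 by omega)) (Fin.castLE_injective _)
    exact h2.map' (WithLp.linearEquiv 2 ℝ (Fin (n + 1) → ℝ)).symm.toLinearMap
      (LinearEquiv.ker _)
  -- `U` is spanned by the first `d` rows of `G`. Their last entries vanish, so `U` is orthogonal to
  -- `e`.
  let U : Submodule ℝ (EuclideanSpace ℝ (Fin (n + 1))) := Submodule.span ℝ (Set.range r)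
  have hU : Module.finrank ℝ U = d := by
    rw [finrank_span_eq_card hr, Fintype.card_fin]
  let u : OrthonormalBasis (Fin d) ℝ U := (stdOrthonormalBasis ℝ U).reindex (finCongr hU)
  let e : EuclideanSpace ℝ (Fin (n + 1)) := EuclideanSpace.single (Fin.last n) 1
  have hUe : ∀ x ∈ U, inner ℝ x e = 0 := by
    intro x hx
    have : U ≤ LinearMap.ker (innerₛₗ ℝ e) := by
      rw [Submodule.span_le]
      rintro _ ⟨i, rfl⟩
      have := hG (Fin.castLE (by omega) i) (by simp)
      rw [SetLike.mem_coe, LinearMap.mem_ker, innerₛₗ_apply_apply, euclidean_inner_eq_sum]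
      simpa [e, r] using this
    rw [real_inner_comm]
    exact this hx
  let v : Fin (n + 1) → EuclideanSpace ℝ (Fin (n + 1)) := fun i => if h : (i : ℕ) < d then (u ⟨i, h⟩ : EuclideanSpace ℝ (Fin (n + 1))) else e
  -- Only these indices are prescribed; `d ≤ n` keeps the last one apart from the first `d`. The
  -- remaining vectors complete an orthonormal basis arbitrarily.
  let S : Set (Fin (n + 1)) := {i | (i : ℕ) < d ∨ i = Fin.last n}
  have hv : Orthonormal ℝ (S.domRestrict v) := by
    rw [orthonormal_iff_ite]
    rintro ⟨i, hi⟩ ⟨j, hj⟩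
    simp only [Set.domRestrict_apply, v, Subtype.mk.injEq]
    by_cases h1 : (i : ℕ) < d <;> by_cases h2 : (j : ℕ) < d
    · have := orthonormal_iff_ite.1 u.orthonormal ⟨i, h1⟩ ⟨j, h2⟩
      simp only [h1, h2, dif_pos]
      rw [← Submodule.coe_inner, this]
      simp [Fin.ext_iff]
    · have hne : i ≠ j := by rintro rfl; exact h2 h1
      simp only [h1, h2, dif_pos, hne, if_false, dif_neg, not_false_eq_true]
      exact hUe _ (u _).2
    · have hne : i ≠ j := by rintro rfl; exact h1 h2
      simp only [h1, h2, dif_pos, hne, if_false, dif_neg, not_false_eq_true]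
      rw [real_inner_comm]
      exact hUe _ (u _).2
    · have hi' : i = Fin.last n := hi.resolve_left h1
      have hj' : j = Fin.last n := hj.resolve_left h2
      subst hi' hj'
      have h1' : ¬ n < d := by simpa using h1
      simp [h1', e]
  obtain ⟨b, hb⟩ := hv.exists_orthonormalBasis_extension_of_card_eq (by simp)
  have hbu (i : Fin (n + 1)) (hi : (i : ℕ) < d) : b i = u ⟨i, hi⟩ := by
    rw [hb i (Or.inl hi)]; simp [v, hi]
  have hbe : b (Fin.last n) = e := by
    rw [hb _ (Or.inr rfl)]
    have : ¬ n < d := by omega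
    simp [v, this]
  let B : Matrix (Fin (n + 1)) (Fin (n + 1)) ℝ := fun i j => b i j
  have hBB : B * Bᵀ = 1 := by
    ext i j
    have := orthonormal_iff_ite.1 b.orthonormal j i
    rw [Matrix.mul_apply, Matrix.one_apply]
    rw [euclidean_inner_eq_sum] at this
    change ∑ l, b i l * b j l = _
    simpa [eq_comm, mul_comm] using this
  have hdet : B.det * B.det = 1 := by
    have := congrArg Matrix.det hBB
    rwa [det_mul, det_transpose, det_one] at this
  -- The last row is multiplied by `det B = ±1` to reach determinant one; the required zero entries
  -- are unaffected.
  let c : Fin (n + 1) → ℝ := fun i => if i = Fin.last n then B.det else 1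
  have hcc : diagonal c * diagonal c = 1 := by
    rw [diagonal_mul_diagonal, ← diagonal_one]
    congr 1; ext i
    simp only [c]; split_ifs <;> simp [hdet]
  let q : Matrix.SpecialLinearGroup (Fin (n + 1)) ℝ := ⟨diagonal c * B, by
    rw [det_mul, det_diagonal, Finset.prod_eq_single (Fin.last n) (by simp +contextual [c])
      (by simp)]
    simp [c, hdet]⟩
  have hqe (i j : Fin (n + 1)) : q.1 i j = c i * b i j := diagonal_mul _ _ _ _
  have hqq : q.1 * q.1ᵀ = 1 := by
    simp only [q, transpose_mul, diagonal_transpose]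
    calc _ = diagonal c * (B * Bᵀ) * diagonal c := by simp only [Matrix.mul_assoc]
      _ = 1 := by rw [hBB, Matrix.mul_one, hcc]
  have hqinv : (q⁻¹).1 = q.1ᵀ := by
    have h1 : (q⁻¹).1 * q.1 = 1 := by
      rw [← Matrix.SpecialLinearGroup.coe_mul, inv_mul_cancel, Matrix.SpecialLinearGroup.coe_one]
    calc (q⁻¹).1 = (q⁻¹).1 * (q.1 * q.1ᵀ) := by rw [hqq, Matrix.mul_one]
      _ = _ := by rw [← Matrix.mul_assoc, h1, Matrix.one_mul]
  refine ⟨q, hqq, fun i hi => ?_, fun i j hi hj => ?_, fun i j hi hj => ?_⟩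
  · have := orthonormal_iff_ite.1 b.orthonormal (Fin.last n) i
    rw [hbe, if_neg (Ne.symm hi)] at this
    rw [hqe]
    rw [euclidean_inner_eq_sum] at this
    simp [e] at this
    simp [this]
  -- As `q⁻¹ = qᵀ`, the entry is, up to `c j`, the inner product of a row of `G` in `U` with `b j`,
  -- which is orthogonal to `U`.
  · have h1 : U ≤ LinearMap.ker (innerₛₗ ℝ (b j)) := by
      intro x hx
      have h2 := congrArg (Subtype.val) (u.sum_repr ⟨x, hx⟩)
      simp only [Submodule.coe_sum, Submodule.coe_smul] at h2
      rw [LinearMap.mem_ker, ← h2, map_sum]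
      refine Finset.sum_eq_zero fun k _ => ?_
      have hk : (k : ℕ) < n + 1 := by omega
      have h3 := orthonormal_iff_ite.1 b.orthonormal j ⟨k, hk⟩
      rw [if_neg (by intro h; have := congrArg Fin.val h; simp at this; omega), hbu ⟨k, hk⟩ k.2] at h3
      rw [map_smul]
      simp only [innerₛₗ_apply_apply]
      rw [show u k = u ⟨k, k.2⟩ from rfl, h3, smul_zero]
    have h2 : r ⟨i, hi⟩ ∈ U := Submodule.subset_span ⟨_, rfl⟩
    have h3 := LinearMap.mem_ker.1 (h1 h2)
    rw [innerₛₗ_apply_apply, euclidean_inner_eq_sum] at h3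
    have h3' : ∑ l, b j l * G.1 i l = 0 := h3
    rw [Matrix.SpecialLinearGroup.coe_mul, hqinv, Matrix.mul_apply]
    simp only [Matrix.transpose_apply, hqe]
    calc _ = c j * ∑ l, b j l * G.1 i l := by
          rw [Finset.mul_sum]; exact Finset.sum_congr rfl fun l _ => by ring
      _ = 0 := by rw [h3', mul_zero]
  -- Here row `i` of `q` lies in `U`, up to the factor `c i`, and column `j` of `G⁻¹` is orthogonal
  -- to the first `d` rows of `G`.
  · let φ : EuclideanSpace ℝ (Fin (n + 1)) →ₗ[ℝ] ℝ := innerₛₗ ℝ (WithLp.toLp 2 fun l => (G⁻¹).1 l j)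
    have h1 : U ≤ LinearMap.ker φ := by
      rw [Submodule.span_le]
      rintro _ ⟨k, rfl⟩
      have h2 : (G * G⁻¹).1 (Fin.castLE (show d ≤ n + 1 by omega) k) j = 0 := by
        rw [mul_inv_cancel, Matrix.SpecialLinearGroup.coe_one, Matrix.one_apply_ne]
        intro h
        have := congrArg Fin.val h
        simp at this
        omega
      rw [Matrix.SpecialLinearGroup.coe_mul, Matrix.mul_apply] at h2
      rw [SetLike.mem_coe, LinearMap.mem_ker]
      simp only [φ, r, innerₛₗ_apply_apply]
      rw [euclidean_inner_eq_sum]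
      simpa [mul_comm] using h2
    have h2 : b i ∈ U := by rw [hbu i hi]; exact (u _).2
    have h3 := LinearMap.mem_ker.1 (h1 h2)
    simp only [φ, innerₛₗ_apply_apply] at h3
    rw [euclidean_inner_eq_sum] at h3
    have h3' : ∑ l, (G⁻¹).1 l j * b i l = 0 := h3
    rw [Matrix.SpecialLinearGroup.coe_mul, Matrix.mul_apply]
    simp only [hqe]
    calc _ = c i * ∑ l, (G⁻¹).1 l j * b i l := by
          rw [Finset.mul_sum]; exact Finset.sum_congr rfl fun l _ => by ring
      _ = 0 := by rw [h3', mul_zero]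

theorem ray_mem_standardChamber (s i : ℕ) {t : ℝ} (ht : 0 ≤ t) :
    ray s i t ∈ standardChamber s := by
  refine ⟨_, _, ?_, rfl⟩
  refine fun j k hjk => mul_le_mul_of_nonneg_right ?_ ht
  by_cases hj : (j : ℕ) < s - i
  · exact (vec_le_lam k).trans_eq (by simp [vec, hj])
  · have hk : ¬ (k : ℕ) < s - i := fun h => hj (lt_of_le_of_lt hjk h)
    simp [vec, hj, hk]

/-- Rotations about the last axis fix the ray `r_1`. -/
theorem act_ray_one_eq {n : ℕ} (q : Matrix.SpecialLinearGroup (Fin (n + 1)) ℝ)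
    (hq : q.1 * q.1ᵀ = 1) (hl : ∀ i, i ≠ Fin.last n → q.1 i (Fin.last n) = 0) (t : ℝ) :
    act (ray (n + 1) 1 t) q = ray (n + 1) 1 t := by
  have hq' : q.1ᵀ * q.1 = 1 := mul_eq_one_comm.1 hq
  have hlast : q.1 (Fin.last n) (Fin.last n) ^ 2 = 1 := by
    have := congrFun (congrFun hq' (Fin.last n)) (Fin.last n)
    rw [Matrix.mul_apply, Finset.sum_eq_single (Fin.last n) (fun i _ hi => by
      simp [hl i hi]) (by simp)] at this
    simpa [sq] using this
  have hrow (j : Fin (n + 1)) (hj : j ≠ Fin.last n) : q.1 (Fin.last n) j = 0 := by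
    have := congrFun (congrFun hq' (Fin.last n)) j
    rw [Matrix.mul_apply, Finset.sum_eq_single (Fin.last n) (fun i _ hi => by
      simp [hl i hi]) (by simp)] at this
    rw [Matrix.one_apply_ne (Ne.symm hj)] at this
    have h0 : q.1 (Fin.last n) (Fin.last n) ≠ 0 := by
      intro h; rw [h] at hlast; norm_num at hlast
    exact (mul_eq_zero.1 this).resolve_left h0
  apply Subtype.ext
  -- `q` is block diagonal for the splitting off of the last axis, and `r_1(t)` is scalar on each
  -- block.
  have hcomm : (ray (n + 1) 1 t).1 * q.1 = q.1 * (ray (n + 1) 1 t).1 := by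
    simp only [ray, diagForm]
    ext i j
    rw [diagonal_mul, mul_diagonal, mul_comm]
    by_cases hi : i = Fin.last n <;> by_cases hj : j = Fin.last n
    · rw [hi, hj]
    · simp [hi, hrow j hj]
    · simp [hj, hl i hi]
    · obtain ⟨i, rfl⟩ := Fin.exists_castSucc_eq.2 hi
      obtain ⟨j, rfl⟩ := Fin.exists_castSucc_eq.2 hj
      simp only [vec_one_castSucc]
  simp only [act]
  rw [Matrix.mul_assoc, hcomm, ← Matrix.mul_assoc, hq', Matrix.one_mul]

/-! ### The case `k = 1`. -/

/-- The ascending function `α_k id` is maximal among the rays of the slope of `r_m`, and the rays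
that attain it infinitely often lie, up to asymptoticity, in a Weyl chamber with a lift of the ray
`r_k`. -/
def MaximalAscent (s m k : ℕ) : Prop :=
  (∀ ρ : ℝ → P s, IsGeodesicRay distP ρ → SameSlope ρ (ray s m) →
    (∃ C : ℝ, ∃ᶠ t in atTop, -fbar s k (proj (ρ t)) ≥ alpha s m k * t + C) →
    (∃ C : ℝ, ∀ t : ℝ, 0 ≤ t → |-fbar s k (proj (ρ t)) - alpha s m k * t| ≤ C) ∧
    (∃ ρ' : ℝ → P s, IsGeodesicRay distP ρ' ∧ Asymptotic distP ρ ρ' ∧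
      ∃ (W : Set (P s)) (γ : Matrix.SpecialLinearGroup (Fin s) ℤ), IsWeylChamber W ∧
        ∀ t : ℝ, 0 ≤ t → ρ' t ∈ W ∧ act (ray s k t) (toReal γ) ∈ W)) ∧
  (∀ ρ : ℝ → P s, IsGeodesicRay distP ρ → SameSlope ρ (ray s m) →
    ∃ C : ℝ, ∀ t : ℝ, 0 ≤ t → -fbar s k (proj (ρ t)) ≤ alpha s m k * t + C) ∧
  (∃ ρ : ℝ → P s, IsGeodesicRay distP ρ ∧ SameSlope ρ (ray s m) ∧
    ∃ C : ℝ, ∀ t : ℝ, 0 ≤ t → |-fbar s k (proj (ρ t)) - alpha s m k * t| ≤ C)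

theorem abs_fbar_one_sub_le {n : ℕ} (hn : 1 ≤ n) (Q R : P (n + 1)) :
    |fbar (n + 1) 1 (proj Q) - fbar (n + 1) 1 (proj R)| ≤ distP Q R := by
  have h1 := fbar_one_le_add_distP hn Q R
  have h2 := fbar_one_le_add_distP hn R Q
  rw [distP_comm R Q] at h2
  exact abs_le.2 ⟨by linarith, by linarith⟩

theorem exists_distP_act_ray_le_of_sameSlope {s m : ℕ} (hm : 1 ≤ m) (hms : m < s) {ρ : ℝ → P s}
    (hρ : IsGeodesicRay distP ρ) (h : SameSlope ρ (ray s m)) :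
    ∃ (g : Matrix.SpecialLinearGroup (Fin s) ℝ) (C : ℝ),
      ∀ t, 0 ≤ t → distP (ρ t) (act (ray s m t) g) ≤ C := by
  obtain ⟨g, hg⟩ := h
  exact ⟨g, hg.exists_distP_le hρ ((isGeodesicRay_ray hm hms).act g)⟩

theorem sameSlope_refl {s : ℕ} (ρ : ℝ → P s) (hρ : IsGeodesicRay distP ρ) : SameSlope ρ ρ := by
  refine ⟨1, asymptotic_of_distP_le (C := 0) fun t ht => ?_⟩
  rw [act_one, hρ t t ht ht, sub_self, abs_zero]

/-- If the boundary subspace of `r_m g` contains the lattice vector `γ e_last`, then up to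
asymptoticity `r_m g` shares a Weyl chamber with a lift of the ray `r_1`. -/
theorem exists_chamber {n m : ℕ} (hm : 1 ≤ m) (hmn : m < n + 1)
    (g : Matrix.SpecialLinearGroup (Fin (n + 1)) ℝ)
    {γ : Matrix.SpecialLinearGroup (Fin (n + 1)) ℤ}
    (hγ : ∀ i : Fin (n + 1), (i : ℕ) < n + 1 - m →
      (g.1 *ᵥ (toReal γ).1 *ᵥ Pi.single (Fin.last n) 1) i = 0) :
    ∃ h : Matrix.SpecialLinearGroup (Fin (n + 1)) ℝ,
      (∃ C, ∀ t, 0 ≤ t → distP (act (ray (n + 1) m t) g) (act (ray (n + 1) m t) h) ≤ C) ∧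
      ∀ t, act (ray (n + 1) 1 t) (toReal γ⁻¹) = act (ray (n + 1) 1 t) h := by
  have hG : ∀ i : Fin (n + 1), (i : ℕ) < n + 1 - m → (g * toReal γ).1 i (Fin.last n) = 0 := by
    intro i hi
    have := hγ i hi
    rw [mulVec_mulVec, ← Matrix.SpecialLinearGroup.coe_mul, Matrix.mulVec_single] at this
    simpa using this
  obtain ⟨q, hq, hl, h1, h2⟩ := exists_rotation (d := n + 1 - m) (by omega) (g * toReal γ) hG
  -- With `h = q γ⁻¹`, `g h⁻¹ = (g γ) q⁻¹` is the parabolic factor, and `q` disappears on `r_1`.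
  refine ⟨q * toReal γ⁻¹, exists_distP_act_ray_le _ _ ?_ ?_, fun t => ?_⟩
  · rw [toReal_inv, _root_.mul_inv_rev, inv_inv, ← mul_assoc]
    exact h1
  · rw [toReal_inv, mul_assoc, ← _root_.mul_inv_rev]
    exact h2
  · rw [act_mul, act_ray_one_eq q hq hl]

theorem maximalAscent_one {n m : ℕ} (hm : 1 ≤ m) (hmn : m < n + 1) :
    MaximalAscent (n + 1) m 1 := by
  have hn : 1 ≤ n := by omega
  have upper : ∀ ρ : ℝ → P (n + 1), IsGeodesicRay distP ρ → SameSlope ρ (ray (n + 1) m) →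
      ∃ C : ℝ, ∀ t : ℝ, 0 ≤ t →
        -fbar (n + 1) 1 (proj (ρ t)) ≤ alpha (n + 1) m 1 * t + C := by
    intro ρ hρ hs
    obtain ⟨g, C, hC⟩ := exists_distP_act_ray_le_of_sameSlope hm hmn hρ hs
    refine ⟨C - fbar (n + 1) 1 (proj (act (ray (n + 1) m 0) g)), fun t ht => ?_⟩
    have h1 := neg_fbar_one_ray_le hn hm g ht
    have h2 := abs_le.1 ((abs_fbar_one_sub_le hn _ _).trans (hC t ht))
    linarith [h2.1]
  refine ⟨?_, upper, ?_⟩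
  · rintro ρ hρ hs ⟨C, hfr⟩
    obtain ⟨C₂, hC₂⟩ := upper ρ hρ hs
    obtain ⟨g, C₁, hC₁⟩ := exists_distP_act_ray_le_of_sameSlope hm hmn hρ hs
    have habs (t : ℝ) (ht : 0 ≤ t) := abs_le.1 ((abs_fbar_one_sub_le hn _ _).trans (hC₁ t ht))
    -- `C₁` is what is lost in replacing `ρ` by `r_m g`.
    obtain ⟨γ, hγ⟩ := exists_orbit_mem_of_frequently hn hm hmn g (C := C - C₁) (by
      refine (hfr.and_eventually (eventually_ge_atTop 0)).mono fun t ⟨ht, ht0⟩ => ?_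
      linarith [(habs t ht0).1])
    obtain ⟨C₃, hC₃⟩ := le_neg_fbar_one_ray hn hm g hγ
    obtain ⟨h, ⟨C₄, hC₄⟩, hray⟩ := exists_chamber hm hmn g hγ
    refine ⟨⟨|C₂| + |C₃| + C₁, fun t ht => ?_⟩, fun t => act (ray (n + 1) m t) h,
      (isGeodesicRay_ray hm hmn).act h, ?_, _, γ⁻¹, ⟨h, rfl⟩, fun t ht => ⟨?_, ?_⟩⟩
    · have hC₁0 : 0 ≤ C₁ := (distP_nonneg _ _).trans (hC₁ t ht)
      refine abs_le.2 ⟨?_, ?_⟩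
      · linarith [hC₃ t, (habs t ht).2, neg_abs_le C₃, abs_nonneg C₂]
      · linarith [hC₂ t ht, le_abs_self C₂, abs_nonneg C₃]
    · refine asymptotic_of_distP_le (C := C₄ + Real.sqrt (n + 1 : ℕ) * C₁) fun t ht => ?_
      refine (distP_le_add_mul (act (ray (n + 1) m t) g) _ _).trans (add_le_add (hC₄ t ht) ?_)
      rw [distP_comm]
      exact mul_le_mul_of_nonneg_left (hC₁ t ht) (Real.sqrt_nonneg _)
    · exact ⟨_, ray_mem_standardChamber _ _ ht, rfl⟩
    · rw [hray]
      exact ⟨_, ray_mem_standardChamber _ _ ht, rfl⟩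
  · have hgeo := isGeodesicRay_ray hm hmn
    have hs := sameSlope_refl _ hgeo
    obtain ⟨C, hC⟩ := upper _ hgeo hs
    -- The ray `r_m` itself attains the speed: the last basis vector is a lattice vector in its
    -- decaying directions.
    obtain ⟨C', hC'⟩ := le_neg_fbar_one_ray hn hm 1 (γ := 1) (by
      intro i hi
      have : i ≠ Fin.last n := by rintro rfl; simp at hi; omega
      rw [toReal_one]
      simp [this])
    refine ⟨ray (n + 1) m, hgeo, hs, |C| + |C'|, fun t ht => ?_⟩
    have h1 := hC' t
    rw [act_one] at h1
    refine abs_le.2 ⟨?_, ?_⟩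
    · linarith [neg_abs_le C', abs_nonneg C]
    · linarith [hC t ht, le_abs_self C, abs_nonneg C']

/-! ### Polarity, and the reduction of `k = s - 1` to `k = 1`. -/

/-- The polarity `Q ↦ J Q⁻¹ J` of `P s`, where `J` reverses the order of the coordinates. -/
def dual {s : ℕ} (Q : P s) : P s :=
  ⟨Q.1⁻¹.submatrix Fin.revPerm Fin.revPerm, Q.2.1.inv.submatrix Fin.revPerm.injective, by
    rw [det_submatrix_equiv_self, det_nonsing_inv, Q.2.2, Ring.inverse_one]⟩

/-- The automorphism of the special linear group that goes with `dual`. -/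
def dualSL {s : ℕ} {R : Type*} [CommRing R] (g : Matrix.SpecialLinearGroup (Fin s) R) :
    Matrix.SpecialLinearGroup (Fin s) R :=
  ⟨(g⁻¹).1ᵀ.submatrix Fin.revPerm Fin.revPerm, by
    rw [det_submatrix_equiv_self, det_transpose]
    exact (g⁻¹).2⟩

theorem dual_dual {s : ℕ} (Q : P s) : dual (dual Q) = Q := by
  apply Subtype.ext
  simp only [dual]
  rw [inv_submatrix_equiv, nonsing_inv_nonsing_inv _ (by rw [Q.2.2]; exact isUnit_one),
    submatrix_submatrix]
  ext i j
  simp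

theorem inv_coe {s : ℕ} (g : Matrix.SpecialLinearGroup (Fin s) ℝ) : (g⁻¹).1 = g.1⁻¹ := by
  refine (Matrix.inv_eq_left_inv ?_).symm
  rw [← Matrix.SpecialLinearGroup.coe_mul, inv_mul_cancel, Matrix.SpecialLinearGroup.coe_one]

theorem dual_act {s : ℕ} (Q : P s) (g : Matrix.SpecialLinearGroup (Fin s) ℝ) :
    dual (act Q g) = act (dual Q) (dualSL g) := by
  apply Subtype.ext
  simp only [dual, act, dualSL]
  rw [transpose_submatrix, submatrix_mul_equiv, submatrix_mul_equiv, transpose_transpose,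
    Matrix.mul_inv_rev, Matrix.mul_inv_rev, inv_coe, transpose_nonsing_inv, ← Matrix.mul_assoc]

theorem toReal_dualSL {s : ℕ} (γ : Matrix.SpecialLinearGroup (Fin s) ℤ) :
    toReal (dualSL γ) = dualSL (toReal γ) := by
  apply Subtype.ext
  have : (toReal γ)⁻¹ = toReal γ⁻¹ := (toReal_inv γ).symm
  simp only [dualSL, this]
  rfl

/-- Inversion changes the signs of the relative exponents, and the distance sees only their squares.
-/
theorem distP_dual {s : ℕ} (Q R : P s) : distP (dual Q) (dual R) = distP Q R := by
  obtain ⟨g, x, -, hg, hQ, hR⟩ := exists_simultaneous_diagonal Q R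
  have hinv : (diagonal fun i => Real.exp (x i))⁻¹ = diagonal fun i => Real.exp (-x i) := by
    apply Matrix.inv_eq_left_inv
    rw [diagonal_mul_diagonal, ← diagonal_one]
    congr 1; ext j; rw [← Real.exp_add, neg_add_cancel, Real.exp_zero]
  rw [distP_eq_of_gram hg hQ hR, distP_eq_of_gram
    (g := (g⁻¹)ᵀ.submatrix (Equiv.refl _) Fin.revPerm) (x := fun i => -x i)]
  · simp
  · rw [Equiv.coe_refl, det_permute', det_transpose]
    exact ((Units.isUnit _).map (Int.castRingHom ℝ)).mul (Matrix.isUnit_nonsing_inv_det _ hg)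
  · simp only [dual, hQ]
    rw [transpose_submatrix, submatrix_mul_equiv, Matrix.mul_inv_rev, transpose_transpose,
      transpose_nonsing_inv]
  · simp only [dual, hR]
    rw [transpose_submatrix, Equiv.coe_refl, ← submatrix_id_id (diagonal fun i => Real.exp (-x i)),
      ← Equiv.coe_refl, submatrix_mul_equiv, submatrix_mul_equiv, Matrix.mul_inv_rev,
      Matrix.mul_inv_rev, transpose_transpose, hinv, transpose_nonsing_inv, Matrix.mul_assoc]

theorem lam_sub {s i : ℕ} (hi : i ≤ s) : lam s (s - i) = mu s i := by
  rw [lam, mu, Nat.cast_sub hi, sub_sub_cancel]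

theorem mu_sub {s i : ℕ} (hi : i ≤ s) : mu s (s - i) = lam s i := by
  rw [lam, mu, Nat.cast_sub hi, sub_sub_cancel]

theorem vec_rev {s i : ℕ} (hi : i ≤ s) (j : Fin s) : vec s i j.rev = -vec s (s - i) j := by
  have hj := j.2
  unfold vec
  rw [lam_sub hi, mu_sub hi, Fin.val_rev]
  split_ifs with h1 h2 h2
  · omega
  · simp
  · simp
  · omega

theorem alpha_sub {s m k : ℕ} (hm : m ≤ s) (hk : k ≤ s) :
    alpha s (s - m) (s - k) = alpha s m k := by
  rw [alpha, alpha, dotProduct, dotProduct, ← Equiv.sum_comp Fin.revPerm]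
  refine Finset.sum_congr rfl fun j _ => ?_
  have h1 := vec_rev hm j.rev
  have h2 := vec_rev hk j.rev
  rw [Fin.rev_rev] at h1 h2
  simp [h1, h2]

theorem dual_diagForm {s : ℕ} (t : Fin s → ℝ) (ht : ∑ j, t j = 0)
    (ht' : ∑ j : Fin s, -t j.rev = 0) :
    dual (diagForm t ht) = diagForm (fun j => -t j.rev) ht' := by
  apply Subtype.ext
  have hinv : (diagonal fun i => Real.exp (t i))⁻¹ = diagonal fun i => Real.exp (-t i) := by
    apply Matrix.inv_eq_left_inv
    rw [diagonal_mul_diagonal, ← diagonal_one]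
    congr 1; ext j; rw [← Real.exp_add, neg_add_cancel, Real.exp_zero]
  simp only [dual, diagForm]
  rw [hinv, submatrix_diagonal_equiv]
  rfl

theorem sum_neg_rev {s : ℕ} {t : Fin s → ℝ} (ht : ∑ j, t j = 0) :
    ∑ j : Fin s, -t j.rev = 0 := by
  rw [Finset.sum_neg_distrib, neg_eq_zero, ← ht]
  exact Equiv.sum_comp Fin.revPerm t

theorem dual_ray {s i : ℕ} (hi : i ≤ s) (t : ℝ) : dual (ray s i t) = ray s (s - i) t := by
  rw [ray, dual_diagForm _ _ (sum_neg_rev (by rw [← Finset.sum_mul, sum_vec, zero_mul])), ray]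
  congr 1
  ext j
  rw [vec_rev hi]
  ring

/-- Inversion alone would turn the decreasing exponents into increasing ones; the reversal `J`
restores the order. -/
theorem dual_mem_standardChamber {s : ℕ} {Q : P s} (h : Q ∈ standardChamber s) :
    dual Q ∈ standardChamber s := by
  obtain ⟨t, ht, hanti, rfl⟩ := h
  refine ⟨_, sum_neg_rev ht, fun i j hij => ?_, dual_diagForm t ht _⟩
  exact neg_le_neg (hanti (Fin.rev_le_rev.2 hij))

theorem IsWeylChamber.dual {s : ℕ} {W : Set (P s)} (h : IsWeylChamber W) :
    IsWeylChamber (SymSpace.dual '' W) := by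
  obtain ⟨g, rfl⟩ := h
  refine ⟨dualSL g, ?_⟩
  rw [Set.image_image]
  ext R
  constructor
  · rintro ⟨Q, hQ, rfl⟩
    exact ⟨_, dual_mem_standardChamber hQ, (dual_act Q g).symm⟩
  · rintro ⟨Q, hQ, rfl⟩
    refine ⟨_, dual_mem_standardChamber hQ, ?_⟩
    simp only [dual_act, dual_dual]

theorem proj_dual_eq {s : ℕ} {Q R : P s} (h : proj Q = proj R) : proj (dual Q) = proj (dual R) := by
  obtain ⟨B, rfl⟩ := proj_eq_proj.1 h
  exact proj_eq_proj.2 ⟨dualSL B, by rw [dual_act, toReal_dualSL]⟩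

theorem proj_dual_eq_iff {s : ℕ} {Q R : P s} : proj (dual Q) = proj R ↔ proj Q = proj (dual R) := by
  constructor
  · intro h; rw [← proj_dual_eq h, dual_dual]
  · intro h; rw [proj_dual_eq h, dual_dual]

theorem distT_dual {s : ℕ} (Q R : P s) :
    distT (proj (dual Q)) (proj (dual R)) = distT (proj Q) (proj R) := by
  unfold distT
  congr 1
  ext a
  constructor
  · rintro ⟨Q₁, Q₂, h1, h2, rfl⟩
    exact ⟨dual Q₁, dual Q₂, proj_dual_eq_iff.2 h1, proj_dual_eq_iff.2 h2, (distP_dual _ _).symm⟩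
  · rintro ⟨Q₁, Q₂, h1, h2, rfl⟩
    exact ⟨dual Q₁, dual Q₂, proj_dual_eq h1, proj_dual_eq h2, (distP_dual _ _).symm⟩

theorem fbar_dual {s k : ℕ} (hk : k ≤ s) (Q : P s) :
    fbar s (s - k) (proj (dual Q)) = fbar s k (proj Q) := by
  unfold fbar busemann
  simp only [← dual_ray hk, distT_dual]

theorem IsGeodesicRay.dual {s : ℕ} {ρ : ℝ → P s} (h : IsGeodesicRay distP ρ) :
    IsGeodesicRay distP (fun t => SymSpace.dual (ρ t)) := by
  intro t u ht hu
  rw [distP_dual, h t u ht hu]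

theorem Asymptotic.dual {s : ℕ} {ρ σ : ℝ → P s} (h : Asymptotic distP ρ σ) :
    Asymptotic distP (fun t => SymSpace.dual (ρ t)) (fun t => SymSpace.dual (σ t)) := by
  simpa only [Asymptotic, distP_dual] using h

theorem SameSlope.dual {s : ℕ} {ρ σ : ℝ → P s} (h : SameSlope ρ σ) :
    SameSlope (fun t => SymSpace.dual (ρ t)) (fun t => SymSpace.dual (σ t)) := by
  obtain ⟨g, hg⟩ := h
  refine ⟨dualSL g, ?_⟩
  simpa only [dual_act] using hg.dual

/-- The polarity is an isometric involution that normalizes the actions of `SL(s, ℝ)` and `SL(s, ℤ)`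
and preserves chambers, so every ingredient of the claim is carried over. -/
theorem MaximalAscent.dual {s m k : ℕ} (hm : m ≤ s) (hk : k ≤ s)
    (h : MaximalAscent s (s - m) (s - k)) : MaximalAscent s m k := by
  have hslope {ρ : ℝ → P s} (hs : SameSlope ρ (ray s m)) :
      SameSlope (fun t => SymSpace.dual (ρ t)) (ray s (s - m)) := by
    simpa only [dual_ray hm] using hs.dual
  obtain ⟨h1, h2, ρ₀, hρ₀, hs₀, C₀, hC₀⟩ := h
  rw [alpha_sub hm hk] at h1 h2 hC₀
  refine ⟨fun ρ hρ hs hfr => ?_, fun ρ hρ hs => ?_, fun t => SymSpace.dual (ρ₀ t), hρ₀.dual, ?_,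
    C₀, fun t ht => ?_⟩
  · obtain ⟨hb, ρ', hρ', has, W, γ, hW, hWm⟩ := h1 _ hρ.dual (hslope hs) (by
      simpa only [fbar_dual hk] using hfr)
    refine ⟨by simpa only [fbar_dual hk] using hb, _, hρ'.dual, ?_, _, dualSL γ, hW.dual,
      fun t ht => ⟨⟨_, (hWm t ht).1, rfl⟩, ⟨_, (hWm t ht).2, ?_⟩⟩⟩
    · simpa only [dual_dual] using has.dual
    · rw [dual_act, ← toReal_dualSL, ← dual_ray hk, dual_dual]
  · simpa only [fbar_dual hk] using h2 _ hρ.dual (hslope hs)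
  · simpa only [← dual_ray hm, dual_dual] using hs₀.dual
  · rw [← fbar_dual hk, dual_dual]
    exact hC₀ t ht

end SymSpace

end

theorem lemma3p2p2 (s m k : ℕ) (hm : 1 ≤ m) (hms : m < s) (hk : k = 1 ∨ k = s - 1) :
    -- rays that ascend at speed `α_k` infinitely often
    (∀ ρ : ℝ → P s, IsGeodesicRay distP ρ → SameSlope ρ (ray s m) →
      (∃ C : ℝ, ∃ᶠ t in Filter.atTop, -fbar s k (proj (ρ t)) ≥ alpha s m k * t + C) →
      (∃ C : ℝ, ∀ t : ℝ, 0 ≤ t → |-fbar s k (proj (ρ t)) - alpha s m k * t| ≤ C) ∧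
      (∃ ρ' : ℝ → P s, IsGeodesicRay distP ρ' ∧ Asymptotic distP ρ ρ' ∧
        ∃ (W : Set (P s)) (γ : Matrix.SpecialLinearGroup (Fin s) ℤ), IsWeylChamber W ∧
          ∀ t : ℝ, 0 ≤ t → ρ' t ∈ W ∧ act (ray s k t) (toReal γ) ∈ W)) ∧
    -- `α_k id` is the maximal ascending function: no ray ascends faster, and some ray attains it
    (∀ ρ : ℝ → P s, IsGeodesicRay distP ρ → SameSlope ρ (ray s m) →
      ∃ C : ℝ, ∀ t : ℝ, 0 ≤ t → -fbar s k (proj (ρ t)) ≤ alpha s m k * t + C) ∧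
    (∃ ρ : ℝ → P s, IsGeodesicRay distP ρ ∧ SameSlope ρ (ray s m) ∧
      ∃ C : ℝ, ∀ t : ℝ, 0 ≤ t → |-fbar s k (proj (ρ t)) - alpha s m k * t| ≤ C) := by
  change MaximalAscent s m k
  obtain ⟨n, rfl⟩ : ∃ n, s = n + 1 := ⟨s - 1, by omega⟩
  rcases hk with hk | hk
  · rw [hk]
    exact maximalAscent_one hm hms
  -- Polarity replaces `k = s - 1` by 1 and `m` by `s - m`, which again lies between 1 and `s - 1`.
  · refine MaximalAscent.dual hms.le (by omega) ?_
    rw [show n + 1 - k = 1 by omega]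
    exact maximalAscent_one (by omega) (by omega)
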